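/- For a group $G$ let $\mathrm{Hol}(G)=G\rtimes\mathrm{Aut}(G)$ be its holomorph (with the tautological action of $\mathrm{Aut}(G)$ on $G$), and let $Q_8$ be the quaternion group of order $8$. (1) The group $\mathrm{Hol}(Q_8)$ has exactly three $S_4$-quotients, i.e. exactly three normal subgroups $N$ with $\mathrm{Hol}(Q_8)/N\cong S_4$. (2) Let $E:y^2=x^3+ax+b$ be an elliptic curve over $\mathbb{Q}$, let $P=(z,w)\in E(\mathbb{Q})\setminus\{\mathcal{O}\}$, and put $d=4a^3+27b^2$ and $$f_{E,Q_8,P}(x)=x^8-8wx^6+6(2az+3b)x^4-d.$$ Define $$h_1=x^4-512dx^2+2^{15}dw^2x+2^{16}d\bigl(d+w^2(12az-36b)\bigr)+2^{18}d\,(27bz^3-9a^2z^2-a^3),$$ $$h_2=x^4-512dx^2+2^{15}dw^2x+2^{16}d\bigl(d+w^2(12az-36b)\bigr),$$ $$h_3=x^4-8wx^3+6(2az+3b)x^2-d.$$ Then the set of roots of $h_3$ in $\overline{\mathbb{Q}}$ is the set of $y$-coordinates of the points $Q\in E(\overline{\mathbb{Q}})$ with $[2]Q=P$. Let $L\subset\overline{\mathbb{Q}}$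 be the splitting field of $f_{E,Q_8,P}$ over $\mathbb{Q}$, and suppose that $\mathrm{Gal}(L/\mathbb{Q})\cong\mathrm{Hol}(Q_8)$. Then there are exactly three subfields $K\subseteq L$ that are Galois over $\mathbb{Q}$ with $\mathrm{Gal}(K/\mathbb{Q})\cong S_4$, and they are the splitting fields over $\mathbb{Q}$ of $h_1$, $h_2$ and $h_3$. -/

import Mathlib

open Polynomial

noncomputable section

/-- The holomorph `Hol(G) = G ⋊ Aut(G)`, where `Aut(G)` acts on `G` in the tautological way. -/
abbrev Holomorph (G : Type*) [Group G] : Type _ :=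
  SemidirectProduct G (MulAut G) (MonoidHom.id (MulAut G))

/-- The holomorph of the quaternion group of order 8 (`QuaternionGroup n` has order `4 * n`). -/
abbrev HolQ8 : Type := Holomorph (QuaternionGroup 2)

/-- The normal subgroups `N` of `G` such that `G ⧸ N` is isomorphic to the symmetric group `S₄`;
they are the same as the `S₄`-quotients of `G`. -/
def s4Kernels (G : Type*) [Group G] : Set (Subgroup G) :=
  {N | ∃ _ : N.Normal, Nonempty ((G ⧸ N) ≃* Equiv.Perm (Fin 4))}

/-- The splitting field over `ℚ` of a polynomial, as a subfield of the algebraic closure of `ℚ`. -/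
def splittingSubfield (p : ℚ[X]) : IntermediateField ℚ (AlgebraicClosure ℚ) :=
  IntermediateField.adjoin ℚ (p.rootSet (AlgebraicClosure ℚ))

/-- The subfields `K` of `L` that are Galois over `ℚ` with Galois group isomorphic to `S₄`. -/
def s4Subfields (L : IntermediateField ℚ (AlgebraicClosure ℚ)) :
    Set (IntermediateField ℚ (AlgebraicClosure ℚ)) :=
  {K | K ≤ L ∧ IsGalois ℚ K ∧ Nonempty (Gal(K/ℚ) ≃* Equiv.Perm (Fin 4))}

/-- The curve `y² = x³ + a x + b` over `ℚ`. -/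
def shortCurve (a b : ℚ) : WeierstrassCurve ℚ := ⟨0, 0, 0, a, b⟩

/-- `d = 4a³ + 27b²`. -/
def dInv (a b : ℚ) : ℚ := 4 * a ^ 3 + 27 * b ^ 2

/-- `f_{E,Q₈,P} = x⁸ - 8 w x⁶ + 6 (2 a z + 3 b) x⁴ - d` for `P = (z, w)`. -/
def fQ8 (a b z w : ℚ) : ℚ[X] :=
  X ^ 8 - C (8 * w) * X ^ 6 + C (6 * (2 * a * z + 3 * b)) * X ^ 4
    - C (dInv a b)

/-- The quartic `h₁`. -/
def h1Poly (a b z w : ℚ) : ℚ[X] :=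
  X ^ 4 - C (512 * dInv a b) * X ^ 2 + C (2 ^ 15 * dInv a b * w ^ 2) * X
    + C (2 ^ 16 * dInv a b * (dInv a b + w ^ 2 * (12 * a * z - 36 * b))
      + 2 ^ 18 * dInv a b * (27 * b * z ^ 3 - 9 * a ^ 2 * z ^ 2 - a ^ 3))

/-- The quartic `h₂`. -/
def h2Poly (a b z w : ℚ) : ℚ[X] :=
  X ^ 4 - C (512 * dInv a b) * X ^ 2 + C (2 ^ 15 * dInv a b * w ^ 2) * X
    + C (2 ^ 16 * dInv a b * (dInv a b + w ^ 2 * (12 * a * z - 36 * b)))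

/-- The quartic `h₃`. -/
def h3Poly (a b z w : ℚ) : ℚ[X] :=
  X ^ 4 - C (8 * w) * X ^ 3 + C (6 * (2 * a * z + 3 * b)) * X ^ 2 - C (dInv a b)

open scoped Classical in
/-- The `y`-coordinates of the points `Q ∈ E(ℚ̄)` with `[2]Q = P`, where `E` is a curve over `ℚ`
and `P = (z, w)` is an affine point of `E(ℚ)`. -/
def halvingYCoords (E : WeierstrassCurve ℚ) (z w : ℚ) : Set (AlgebraicClosure ℚ) :=
  {y | ∃ (x : AlgebraicClosure ℚ)
      (hQ : (E.baseChange (AlgebraicClosure ℚ)).toAffine.Nonsingular x y)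
      (hP : (E.baseChange (AlgebraicClosure ℚ)).toAffine.Nonsingular
        (algebraMap ℚ (AlgebraicClosure ℚ) z) (algebraMap ℚ (AlgebraicClosure ℚ) w)),
    2 • WeierstrassCurve.Affine.Point.some x y hQ =
      WeierstrassCurve.Affine.Point.some _ _ hP}

end

/-! ### Generators of Hol(Q₈) and its three maps onto S₄ -/

section GroupTheory

open Equiv (Perm swap)
open scoped Pointwise

/-! Group side: Hol(Q₈) is generated by i, the automorphism i ↦ j ↦ k ↦ i and the exchange of i and
j. Three relations among them leave, up to conjugacy, only three generating triples in S₄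
(`perm_triple_classification`). All three occur, and their kernels differ. By the Galois
correspondence an extension with group Hol(Q₈) has at most three S₄-subfields.

Field side: let lᵢ be the slopes of the tangents to E through -P. The tangency points are the halves
of P, and their y-coordinates yᵢ = ∏_{j≠i} (lᵢ - lⱼ)/8 are the roots of h₃. Since f(x) = h₃(x²), the
roots of f are ±tᵢ with tᵢ² = yᵢ, and the tᵢ can be chosen so that ∏ tᵢ is a rational multiple of
the Vandermonde determinant of the lᵢ. An automorphism therefore permutes the lᵢ by some σ and sends
tᵢ to ±t_{σ(i)}, with signs multiplying to sign σ. There are only 192 such signed permutations,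
while Hol(Q₈) has order at least 192; hence L = ℚ(lᵢ, tᵢ) and every signed permutation is realised
(`exists_algEquiv_signedPerm`).

The roots of h₁ and h₂ are the sums ±X ± Y ± Z with an even number of minus signs, where X, Y, Z are
explicit multiples of the tₘt₀(lᵢ - lⱼ). Chosen signed permutations act on the roots of each hᵢ as a
transposition and a 3-cycle, so each splitting field has group S₄. Others tell the three fields
apart, so the bound of three is attained (`s4_subfields_of_holQ8`). -/

theorem exists_permHom {A Z ι : Type*} [Group A] [MulAction A Z] (c : ι → Z)
    (hc : Function.Injective c) (h : ∀ (g : A) i, ∃ j, g • c i = c j) :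
    ∃ ψ : A →* Perm ι, ∀ g i, g • c i = c (ψ g i) := by
  choose f hf using h
  have f_mul : ∀ g g' i, f (g * g') i = f g (f g' i) := fun g g' i => hc <| by
    rw [← hf, mul_smul, hf, hf]
  have f_one : ∀ i, f 1 i = i := fun i => hc <| by rw [← hf, one_smul]
  refine ⟨MonoidHom.mk' (fun g => ⟨f g, f g⁻¹, fun i => ?_, fun i => ?_⟩) ?_, fun g i => hf g i⟩
  · rw [← f_mul, inv_mul_cancel, f_one]
  · rw [← f_mul, mul_inv_cancel, f_one]
  · intro g g'
    exact Equiv.ext fun i => f_mul g g' i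

/-- The setwise stabiliser of the family is a subgroup, so generators suffice. Both inclusions are
asked for because stabilising means g • S = S. -/
theorem exists_permHom_of_closure {A Z ι : Type*} [Group A] [MulAction A Z] (c : ι → Z)
    (hc : Function.Injective c) {s : Set A} (hs : Subgroup.closure s = ⊤)
    (h : ∀ g ∈ s, (∀ i, ∃ j, g • c i = c j) ∧ ∀ j, ∃ i, g • c i = c j) :
    ∃ ψ : A →* Perm ι, ∀ g i, g • c i = c (ψ g i) := by
  have key : Subgroup.closure s ≤ MulAction.stabilizer A (Set.range c) := by
    rw [Subgroup.closure_le]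
    intro g hg
    rw [SetLike.mem_coe, MulAction.mem_stabilizer_iff]
    apply Set.Subset.antisymm
    · rintro _ ⟨_, ⟨i, rfl⟩, rfl⟩
      obtain ⟨j, hj⟩ := (h g hg).1 i
      exact ⟨j, hj.symm⟩
    · rintro _ ⟨j, rfl⟩
      obtain ⟨i, hi⟩ := (h g hg).2 j
      exact ⟨c i, ⟨i, rfl⟩, hi⟩
  refine exists_permHom c hc fun g i => ?_
  have hg : g ∈ MulAction.stabilizer A (Set.range c) := key (hs ▸ Subgroup.mem_top g)
  have : g • c i ∈ g • Set.range c := Set.smul_mem_smul_set ⟨i, rfl⟩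
  rw [MulAction.mem_stabilizer_iff.1 hg] at this
  obtain ⟨j, hj⟩ := this
  exact ⟨j, hj.symm⟩

/-- The 3-cycle `(1 2 3)`. -/
abbrev threeCycle : Perm (Fin 4) := swap 1 2 * swap 2 3

/-- The product (0 1)(1 2 3) is a 4-cycle, and a 4-cycle with an adjacent transposition generates
S₄. -/
theorem Subgroup.eq_top_of_swap_of_threeCycle (H : Subgroup (Perm (Fin 4)))
    (h₁ : swap 0 1 ∈ H) (h₂ : threeCycle ∈ H) : H = ⊤ := by
  have hc : (finRotate 4) = swap 0 1 * threeCycle := by decide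
  have h := Equiv.Perm.closure_cycle_adjacent_swap (σ := finRotate 4) (isCycle_finRotate (n := 2))
    (support_finRotate (n := 2)) 0
  rw [eq_top_iff, ← h, Subgroup.closure_le]
  rintro x (rfl | rfl)
  · rw [hc]; exact H.mul_mem h₁ h₂
  · exact h₁

open QuaternionGroup in
/-- The automorphism `i ↦ j ↦ k ↦ i` of `Q₈`. -/
def cycleAut : MulAut (QuaternionGroup 2) where
  toFun x := match x with
    | a n => xa 0 ^ n.val
    | xa n => xa 3 * xa 0 ^ n.val
  invFun x := match x with
    | a n => xa 3 ^ n.val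
    | xa n => a 1 * xa 3 ^ n.val
  left_inv := by decide
  right_inv := by decide
  map_mul' := by decide

open QuaternionGroup in
/-- The automorphism of `Q₈` exchanging `i` and `j`. -/
def swapAut : MulAut (QuaternionGroup 2) where
  toFun x := match x with
    | a n => xa 0 ^ n.val
    | xa n => a 1 * xa 0 ^ n.val
  invFun x := match x with
    | a n => xa 0 ^ n.val
    | xa n => a 1 * xa 0 ^ n.val
  left_inv := by decide
  right_inv := by decide
  map_mul' := by decide

theorem quaternionGroup_eq_pow_mul_pow : ∀ x : QuaternionGroup 2,
    ∃ (s : Fin 2) (n : Fin 4), x = .xa 0 ^ s.val * .a 1 ^ n.val := by decide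

/-- The images of i and j under an automorphism do not commute, and they determine it. Words of this
shape reach all 24 noncommuting pairs, so the two automorphisms generate Aut(Q₈). -/
theorem exists_aut_word : ∀ u v : QuaternionGroup 2, u * v ≠ v * u →
    ∃ (m : Fin 3) (p : Fin 2) (n : Fin 3) (q : Fin 2) (l : Fin 3) (r : Fin 2),
      (cycleAut ^ m.val * swapAut ^ p.val * cycleAut ^ n.val * swapAut ^ q.val * cycleAut ^ l.val *
        swapAut ^ r.val) (.a 1) = u ∧
      (cycleAut ^ m.val * swapAut ^ p.val * cycleAut ^ n.val * swapAut ^ q.val * cycleAut ^ l.val *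
        swapAut ^ r.val) (.xa 0) = v := by
  decide +kernel

theorem mulAut_ext {α β : MulAut (QuaternionGroup 2)} (hi : α (.a 1) = β (.a 1))
    (hj : α (.xa 0) = β (.xa 0)) : α = β := by
  ext x
  obtain ⟨s, n, rfl⟩ := quaternionGroup_eq_pow_mul_pow x
  simp only [map_mul, map_pow, hi, hj]

theorem closure_cycleAut_swapAut : Subgroup.closure {cycleAut, swapAut} = ⊤ := by
  rw [eq_top_iff]
  intro α _
  have hne : α (.a 1) * α (.xa 0) ≠ α (.xa 0) * α (.a 1) := by
    rw [← map_mul, ← map_mul]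
    exact fun h => absurd (α.injective h) (by decide)
  obtain ⟨m, p, n, q, l, r, hi, hj⟩ := exists_aut_word _ _ hne
  rw [← mulAut_ext hi hj]
  have h₁ : cycleAut ∈ Subgroup.closure {cycleAut, swapAut} := Subgroup.subset_closure (by simp)
  have h₂ : swapAut ∈ Subgroup.closure {cycleAut, swapAut} := Subgroup.subset_closure (by simp)
  exact mul_mem (mul_mem (mul_mem (mul_mem (mul_mem (pow_mem h₁ _) (pow_mem h₂ _)) (pow_mem h₁ _))
    (pow_mem h₂ _)) (pow_mem h₁ _)) (pow_mem h₂ _)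

/-- The generator `i` of `Hol(Q₈)`. -/
def holGen₁ : HolQ8 := SemidirectProduct.inl (.a 1)

/-- The generator `i ↦ j ↦ k ↦ i` of `Hol(Q₈)`. -/
def holGen₂ : HolQ8 := SemidirectProduct.inr cycleAut

/-- The generator of `Hol(Q₈)` exchanging `i` and `j`. -/
def holGen₃ : HolQ8 := SemidirectProduct.inr swapAut

theorem closure_holGen : Subgroup.closure {holGen₁, holGen₂, holGen₃} = ⊤ := by
  set S : Subgroup HolQ8 := Subgroup.closure {holGen₁, holGen₂, holGen₃} with hS
  have h₁ : holGen₁ ∈ S := Subgroup.subset_closure (by simp)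
  have h₂ : holGen₂ ∈ S := Subgroup.subset_closure (by simp)
  have h₃ : holGen₃ ∈ S := Subgroup.subset_closure (by simp)
  have hr : ∀ α : MulAut (QuaternionGroup 2), SemidirectProduct.inr α ∈ S := by
    intro α
    have : (⊤ : Subgroup (MulAut (QuaternionGroup 2))) ≤ S.comap SemidirectProduct.inr := by
      rw [← closure_cycleAut_swapAut, Subgroup.closure_le]
      rintro x (rfl | rfl)
      · exact h₂
      · exact h₃
    exact this (Subgroup.mem_top α)
  have hj : (SemidirectProduct.inl (.xa 0) : HolQ8) ∈ S := by
    have : (SemidirectProduct.inl (.xa 0) : HolQ8) = holGen₂ * holGen₁ * holGen₂⁻¹ := by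
      have := SemidirectProduct.inl_aut (φ := MonoidHom.id (MulAut (QuaternionGroup 2)))
        cycleAut (.a 1)
      rw [map_inv] at this
      exact this
    rw [this]
    exact mul_mem (mul_mem h₂ h₁) (inv_mem h₂)
  rw [eq_top_iff]
  intro g _
  rw [← SemidirectProduct.inl_left_mul_inr_right g]
  refine mul_mem ?_ (hr _)
  obtain ⟨s, n, h⟩ := quaternionGroup_eq_pow_mul_pow g.left
  rw [h, map_mul, map_pow, map_pow]
  exact mul_mem (pow_mem hj _) (pow_mem h₁ _)

/-- The four pairs `{T, -T}`, where `T` contains one element of each of `{±i}`, `{±j}`, `{±k}`. -/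
def triplePairs : Fin 4 → Finset (Finset (QuaternionGroup 2)) :=
  ![{{.a 1, .xa 0, .xa 3}, {.a 3, .xa 2, .xa 1}}, {{.a 1, .xa 2, .xa 1}, {.a 3, .xa 0, .xa 3}},
    {{.a 3, .xa 0, .xa 1}, {.a 1, .xa 2, .xa 3}}, {{.a 3, .xa 2, .xa 3}, {.a 1, .xa 0, .xa 1}}]

/-- The four cosets of the centre of `Q₈`. -/
def centerCosets : Fin 4 → Finset (QuaternionGroup 2) :=
  ![{.a 0, .a 2}, {.a 1, .a 3}, {.xa 0, .xa 2}, {.xa 1, .xa 3}]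

/-- With ±i, ±j, ±k as the faces of a cube, the pairs {T, -T} are its four diagonals, on which
Aut(Q₈) acts as the rotation group. -/
theorem exists_mulAut_permHom : ∃ ψ : MulAut (QuaternionGroup 2) →* Perm (Fin 4),
    ψ (MulAut.conj (.a 1)) = swap 0 1 * swap 2 3 ∧ ψ cycleAut = threeCycle ∧
      ψ swapAut = swap 0 3 := by
  have hinj : Function.Injective triplePairs := by decide
  obtain ⟨ψ, hψ⟩ := exists_permHom_of_closure (A := MulAut (QuaternionGroup 2)) triplePairs hinj
    closure_cycleAut_swapAut (by
      rintro g (rfl | rfl)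
      · decide +kernel
      · decide +kernel)
  refine ⟨ψ, ?_, ?_, ?_⟩ <;> ext i : 1 <;> refine hinj ?_ <;> rw [← hψ] <;> revert i <;>
    decide +kernel

/-- The action of `Hol(Q₈)` on `Q₈` by affine maps. -/
def affineHom : HolQ8 →* Perm (QuaternionGroup 2) :=
  SemidirectProduct.lift (MulAction.toPermHom _ _) (MulAction.toPermHom _ _) (by
    intro α
    ext q x
    simp)

/-- The homomorphism `(q, α) ↦ conj q * α`. -/
def conjHom : HolQ8 →* MulAut (QuaternionGroup 2) :=
  SemidirectProduct.lift MulAut.conj (MonoidHom.id _) (by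
    intro α
    ext q x
    simp)

/-- The sources are the projection to Aut(Q₈), its twist by inner automorphisms `conjHom`, and the
affine action on Q₈ modulo its centre, a plane over 𝔽₂. -/
theorem exists_hol_permHom :
    (∃ φ : HolQ8 →* Perm (Fin 4),
      φ holGen₁ = 1 ∧ φ holGen₂ = threeCycle ∧ φ holGen₃ = swap 0 3) ∧
    (∃ φ : HolQ8 →* Perm (Fin 4),
      φ holGen₁ = swap 0 1 * swap 2 3 ∧ φ holGen₂ = threeCycle ∧ φ holGen₃ = swap 0 3) ∧
    (∃ φ : HolQ8 →* Perm (Fin 4),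
      φ holGen₁ = swap 0 1 * swap 2 3 ∧ φ holGen₂ = threeCycle ∧ φ holGen₃ = swap 1 2) := by
  obtain ⟨ψ, h₁, h₂, h₃⟩ := exists_mulAut_permHom
  refine ⟨⟨ψ.comp SemidirectProduct.rightHom, ?_, ?_, ?_⟩, ⟨ψ.comp conjHom, ?_, ?_, ?_⟩, ?_⟩
  · simp [holGen₁]
  · simpa [holGen₂] using h₂
  · simpa [holGen₃] using h₃
  · simpa [holGen₁, conjHom] using h₁
  · simpa [holGen₂, conjHom] using h₂
  · simpa [holGen₃, conjHom] using h₃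
  · let _ : MulAction HolQ8 (Finset (QuaternionGroup 2)) := MulAction.compHom _ affineHom
    have hinj : Function.Injective centerCosets := by decide
    obtain ⟨φ, hφ⟩ := exists_permHom_of_closure (A := HolQ8) centerCosets hinj
      closure_holGen (by
        rintro g (rfl | rfl | rfl)
        · decide +kernel
        · decide +kernel
        · decide +kernel)
    refine ⟨φ, ?_, ?_, ?_⟩ <;> ext i : 1 <;> refine hinj ?_ <;> rw [← hφ] <;> revert i <;>
      decide +kernel

set_option synthInstance.maxSize 1000 in
set_option synthInstance.maxHeartbeats 400000 in
-- Every proper subgroup of S₄ fixes a point, lies in A₄ or commutes with a nontrivial element. The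
-- first three alternatives thus collect the triples that do not generate; the last lists generating
-- triples up to conjugacy.
theorem perm_triple_classification : ∀ c d x : Perm (Fin 4), c ^ 3 = 1 → d ^ 2 = 1 →
    x * c * c * x * c * d * x * d = 1 →
    (∃ n, x n = n ∧ c n = n ∧ d n = n) ∨
    (Perm.sign x = 1 ∧ Perm.sign c = 1 ∧ Perm.sign d = 1) ∨
    (∃ v, v ≠ 1 ∧ v * x = x * v ∧ v * c = c * v ∧ v * d = d * v) ∨
    ∃ s : Perm (Fin 4), s * c * s⁻¹ = threeCycle ∧
      ((s * x * s⁻¹ = 1 ∧ s * d * s⁻¹ = swap 0 3) ∨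
       (s * x * s⁻¹ = swap 0 1 * swap 2 3 ∧ s * d * s⁻¹ = swap 0 3) ∨
       (s * x * s⁻¹ = swap 0 1 * swap 2 3 ∧ s * d * s⁻¹ = swap 1 2)) := by
  decide +kernel

/-- These need not present the group; they only have to be strong enough for the finite check above.
-/
theorem holGen_relations : holGen₂ ^ 3 = 1 ∧ holGen₃ ^ 2 = 1 ∧
    holGen₁ * holGen₂ * holGen₂ * holGen₁ * holGen₂ * holGen₃ * holGen₁ * holGen₃ = 1 := by
  refine ⟨SemidirectProduct.ext ?_ ?_, SemidirectProduct.ext ?_ ?_, SemidirectProduct.ext ?_ ?_⟩ <;>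
    decide +kernel

end GroupTheory

/-! ### Classification of the S₄-quotients of Hol(Q₈) -/

section GroupTheory

open Equiv (Perm swap)

theorem surjective_of_range_eq_top {G : Type*} [Group G] (φ : G →* Perm (Fin 4))
    (h₁ : swap 0 1 ∈ φ.range) (h₂ : threeCycle ∈ φ.range) : Function.Surjective φ :=
  MonoidHom.range_eq_top.1 (Subgroup.eq_top_of_swap_of_threeCycle _ h₁ h₂)

theorem surjective_of_swap_zero_three {G : Type*} [Group G] (φ : G →* Perm (Fin 4)) {c d : G}
    (hc : φ c = threeCycle) (hd : φ d = swap 0 3) : Function.Surjective φ := by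
  refine surjective_of_range_eq_top φ ⟨c * d * c⁻¹, ?_⟩ ⟨c, hc⟩
  rw [map_mul, map_mul, map_inv, hc, hd]
  decide

theorem surjective_of_swap_one_two {G : Type*} [Group G] (φ : G →* Perm (Fin 4)) {c d x : G}
    (hc : φ c = threeCycle) (hx : φ x = swap 0 1 * swap 2 3) (hd : φ d = swap 1 2) :
    Function.Surjective φ := by
  refine surjective_of_swap_zero_three φ (d := x * d * x⁻¹) hc ?_
  rw [map_mul, map_mul, map_inv, hx, hd]
  decide

theorem ker_mem_s4Kernels {G : Type*} [Group G] {φ : G →* Perm (Fin 4)}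
    (h : Function.Surjective φ) : φ.ker ∈ s4Kernels G :=
  ⟨inferInstance, ⟨QuotientGroup.quotientKerEquivOfSurjective φ h⟩⟩

theorem holHom_mem_of_gens {G : Type*} [Group G] (φ : HolQ8 →* G) (S : Subgroup G)
    (h₁ : φ holGen₁ ∈ S) (h₂ : φ holGen₂ ∈ S) (h₃ : φ holGen₃ ∈ S) (g : HolQ8) : φ g ∈ S := by
  have : Subgroup.closure {holGen₁, holGen₂, holGen₃} ≤ S.comap φ := by
    rw [Subgroup.closure_le]
    rintro x (rfl | rfl | rfl)
    exacts [h₁, h₂, h₃]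
  exact this (closure_holGen ▸ Subgroup.mem_top g)

theorem holHom_ext {G : Type*} [Group G] {φ ψ : HolQ8 →* G} (h₁ : φ holGen₁ = ψ holGen₁)
    (h₂ : φ holGen₂ = ψ holGen₂) (h₃ : φ holGen₃ = ψ holGen₃) : φ = ψ := by
  refine MonoidHom.eq_of_eqOn_dense closure_holGen ?_
  rintro x (rfl | rfl | rfl)
  exacts [h₁, h₂, h₃]

theorem holHom_ker_eq_of_conj {φ ψ : HolQ8 →* Perm (Fin 4)} (s : Perm (Fin 4))
    (h₁ : s * φ holGen₁ * s⁻¹ = ψ holGen₁) (h₂ : s * φ holGen₂ * s⁻¹ = ψ holGen₂)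
    (h₃ : s * φ holGen₃ * s⁻¹ = ψ holGen₃) : φ.ker = ψ.ker := by
  have : ψ = (MulAut.conj s).toMonoidHom.comp φ :=
    (holHom_ext (by simpa using h₁) (by simpa using h₂) (by simpa using h₃)).symm
  ext g
  simp [this, MonoidHom.mem_ker]

theorem holHom_classification (φ : HolQ8 →* Perm (Fin 4)) (hφ : Function.Surjective φ) :
    ∃ s : Perm (Fin 4), s * φ holGen₂ * s⁻¹ = threeCycle ∧
      ((s * φ holGen₁ * s⁻¹ = 1 ∧ s * φ holGen₃ * s⁻¹ = swap 0 3) ∨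
       (s * φ holGen₁ * s⁻¹ = swap 0 1 * swap 2 3 ∧ s * φ holGen₃ * s⁻¹ = swap 0 3) ∨
       (s * φ holGen₁ * s⁻¹ = swap 0 1 * swap 2 3 ∧ s * φ holGen₃ * s⁻¹ = swap 1 2)) := by
  obtain ⟨r₁, r₂, r₃⟩ := holGen_relations
  have key := perm_triple_classification (φ holGen₂) (φ holGen₃) (φ holGen₁)
    (by rw [← map_pow, r₁, map_one]) (by rw [← map_pow, r₂, map_one])
    (by simpa only [map_mul, map_one] using congrArg φ r₃)
  -- Each of the first three cases traps the image in a proper subgroup, against surjectivity.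
  rcases key with ⟨n, hx, hc, hd⟩ | ⟨hx, hc, hd⟩ | ⟨v, hv, hx, hc, hd⟩ | h
  · have h := holHom_mem_of_gens φ (MulAction.stabilizer _ n) hx hc hd
    obtain ⟨g, hg⟩ := hφ (swap n (n + 1))
    have h := h g
    rw [hg, MulAction.mem_stabilizer_iff, Perm.smul_def, Equiv.swap_apply_left] at h
    exact absurd h ((by decide : ∀ n : Fin 4, n + 1 ≠ n) n)
  · have h := holHom_mem_of_gens φ Perm.sign.ker hx hc hd
    obtain ⟨g, hg⟩ := hφ (swap 0 1)
    have h := h g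
    rw [hg] at h
    exact absurd h (by decide)
  · have h := holHom_mem_of_gens φ (Subgroup.centralizer {v})
      (Subgroup.mem_centralizer_singleton_iff.2 hx.symm)
      (Subgroup.mem_centralizer_singleton_iff.2 hc.symm)
      (Subgroup.mem_centralizer_singleton_iff.2 hd.symm)
    have hcen : ∀ v : Perm (Fin 4), (∀ u : Perm (Fin 4), u * v = v * u) → v = 1 := by
      decide +kernel
    refine absurd (hcen v fun u => ?_) hv
    obtain ⟨g, rfl⟩ := hφ u
    exact Subgroup.mem_centralizer_singleton_iff.1 (h g)
  · exact h

theorem ncard_s4Kernels_holQ8 : (s4Kernels HolQ8).ncard = 3 := by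
  obtain ⟨⟨φ₁, a₁, a₂, a₃⟩, ⟨φ₂, b₁, b₂, b₃⟩, ⟨φ₃, c₁, c₂, c₃⟩⟩ := exists_hol_permHom
  have hset : s4Kernels HolQ8 = {φ₁.ker, φ₂.ker, φ₃.ker} := by
    apply Set.Subset.antisymm
    · rintro N ⟨hN, ⟨e⟩⟩
      set φ : HolQ8 →* Perm (Fin 4) := e.toMonoidHom.comp (QuotientGroup.mk' N) with hφdef
      have hker : φ.ker = N := by
        ext g
        simp [hφdef]
      obtain ⟨s, h₂, h⟩ := holHom_classification φ
        (e.surjective.comp (QuotientGroup.mk'_surjective N))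
      rw [← hker]
      rcases h with ⟨h₁, h₃⟩ | ⟨h₁, h₃⟩ | ⟨h₁, h₃⟩
      · left
        exact holHom_ker_eq_of_conj s (h₁.trans a₁.symm) (h₂.trans a₂.symm) (h₃.trans a₃.symm)
      · right; left
        exact holHom_ker_eq_of_conj s (h₁.trans b₁.symm) (h₂.trans b₂.symm) (h₃.trans b₃.symm)
      · right; right
        exact holHom_ker_eq_of_conj s (h₁.trans c₁.symm) (h₂.trans c₂.symm) (h₃.trans c₃.symm)
    · rintro N (rfl | rfl | rfl)
      · exact ker_mem_s4Kernels (surjective_of_swap_zero_three _ a₂ a₃)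
      · exact ker_mem_s4Kernels (surjective_of_swap_zero_three _ b₂ b₃)
      · exact ker_mem_s4Kernels (surjective_of_swap_one_two _ c₂ c₁ c₃)
  have hne : swap 0 1 * swap 2 3 ≠ (1 : Perm (Fin 4)) := by decide
  rw [hset, Set.ncard_eq_three]
  refine ⟨_, _, _, fun h => ?_, fun h => ?_, fun h => ?_, rfl⟩
  · have : holGen₁ ∈ φ₂.ker := h ▸ a₁
    exact hne (b₁.symm.trans this)
  · have : holGen₁ ∈ φ₃.ker := h ▸ a₁
    exact hne (c₁.symm.trans this)
  -- The product of these generators maps to a 4-cycle under φ₂ and to a transposition under φ₃.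
  · have h₃ : (holGen₂ * holGen₃) ^ 2 ∈ φ₃.ker := by
      rw [MonoidHom.mem_ker, map_pow, map_mul, c₂, c₃]; decide
    rw [← h, MonoidHom.mem_ker, map_pow, map_mul, b₂, b₃] at h₃
    exact absurd h₃ (by decide)

theorem le_card_holQ8 : 192 ≤ Nat.card HolQ8 := by
  obtain ⟨ψ, -, h₂, h₃⟩ := exists_mulAut_permHom
  have h := Nat.card_le_card_of_surjective ψ (surjective_of_swap_zero_three ψ h₂ h₃)
  rw [Nat.card_perm, Nat.card_fin] at h
  have h8 : Nat.card (QuaternionGroup 2) = 8 := by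
    rw [Nat.card_eq_fintype_card, QuaternionGroup.card]
  have h24 : Nat.factorial 4 = 24 := rfl
  rw [SemidirectProduct.card, h8]
  omega

end GroupTheory

/-! ### S₄-subfields through the Galois correspondence -/

section GaloisTheory

open Equiv (Perm swap)
open IntermediateField

theorem s4Kernels_map {G H : Type*} [Group G] [Group H] (e : G ≃* H) {N : Subgroup G}
    (hN : N ∈ s4Kernels G) : N.map e.toMonoidHom ∈ s4Kernels H := by
  obtain ⟨hn, ⟨f⟩⟩ := hN
  have : (N.map e.toMonoidHom).Normal := hn.map _ e.surjective
  exact ⟨this, ⟨(QuotientGroup.congr N (N.map e.toMonoidHom) e rfl).symm.trans f⟩⟩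

variable {k Ω : Type*} [Field k] [Field Ω] [Algebra k Ω]

theorem fixingSubgroup_restrict_mem_s4Kernels {K L : IntermediateField k Ω} [Normal k L]
    (hKL : K ≤ L) [IsGalois k K] (f : Gal(K/k) ≃* Perm (Fin 4)) :
    (restrict hKL).fixingSubgroup ∈ s4Kernels Gal(L/k) := by
  let g : K ≃ₐ[k] restrict hKL := restrictAlgEquiv hKL
  have : IsGalois k (restrict hKL) := IsGalois.of_algEquiv g
  have hs := AlgEquiv.restrictNormalHom_surjective (F := k) (K₁ := restrict hKL) L
  rw [← restrictNormalHom_ker]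
  exact ⟨inferInstance,
    ⟨(QuotientGroup.quotientKerEquivOfSurjective _ hs).trans ((AlgEquiv.autCongr g).symm.trans f)⟩⟩

theorem setOf_s4_finite_and_ncard_le {L : IntermediateField k Ω}
    [FiniteDimensional k L] [IsGalois k L] (e : Gal(L/k) ≃* HolQ8) :
    {K | K ≤ L ∧ IsGalois k K ∧ Nonempty (Gal(K/k) ≃* Perm (Fin 4))}.Finite ∧
    {K | K ≤ L ∧ IsGalois k K ∧ Nonempty (Gal(K/k) ≃* Perm (Fin 4))}.ncard ≤ 3 := by
  classical
  set S := {K | K ≤ L ∧ IsGalois k K ∧ Nonempty (Gal(K/k) ≃* Perm (Fin 4))}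
  have hfin : (s4Kernels HolQ8).Finite :=
    Set.finite_of_ncard_ne_zero (by rw [ncard_s4Kernels_holQ8]; norm_num)
  -- K ↦ Gal(L/K), carried to Hol(Q₈); the value ⊥ is never used on S.
  let F : IntermediateField k Ω → Subgroup HolQ8 := fun K =>
    if h : K ≤ L then (restrict h).fixingSubgroup.map e.toMonoidHom else ⊥
  have hF : ∀ K ∈ S, F K ∈ s4Kernels HolQ8 := by
    rintro K ⟨hK, _, ⟨f⟩⟩
    have : F K = (restrict hK).fixingSubgroup.map e.toMonoidHom := dif_pos hK
    rw [this]
    exact s4Kernels_map e (fixingSubgroup_restrict_mem_s4Kernels hK f)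
  have hinj : Set.InjOn F S := by
    intro K hK K' hK' h
    have h₁ : F K = (restrict hK.1).fixingSubgroup.map e.toMonoidHom := dif_pos hK.1
    have h₂ : F K' = (restrict hK'.1).fixingSubgroup.map e.toMonoidHom := dif_pos hK'.1
    rw [h₁, h₂] at h
    have h := Subgroup.map_injective e.injective h
    have h : restrict hK.1 = restrict hK'.1 := by
      rw [← IsGalois.fixedField_fixingSubgroup (restrict hK.1), h,
        IsGalois.fixedField_fixingSubgroup]
    rw [← lift_restrict hK.1, h, lift_restrict]
  refine ⟨Set.Finite.of_injOn hF hinj hfin, ?_⟩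
  rw [← ncard_s4Kernels_holQ8]
  exact Set.ncard_le_ncard_of_injOn F hF hinj hfin

theorem rootSet_eq_range {ι : Type*} [Fintype ι] {p : k[X]} {x : ι → Ω}
    (hp : p.map (algebraMap k Ω) = ∏ i, (X - C (x i))) : p.rootSet Ω = Set.range x := by
  ext y
  have hne : p.map (algebraMap k Ω) ≠ 0 :=
    hp ▸ Finset.prod_ne_zero_iff.2 fun i _ => X_sub_C_ne_zero _
  rw [mem_rootSet', and_iff_right hne, aeval_def, ← eval_map, hp, eval_prod,
    Finset.prod_eq_zero_iff]
  simp [sub_eq_zero, eq_comm]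

theorem isGalois_adjoin_rootSet [IsAlgClosed Ω] [PerfectField k] (p : k[X]) :
    IsGalois k (adjoin k (p.rootSet Ω)) := by
  have := adjoin_rootSet_isSplittingField (IsAlgClosed.splits (p.map (algebraMap k Ω)))
  have : FiniteDimensional k (adjoin k (p.rootSet Ω)) := IsSplittingField.finiteDimensional _ p
  have : Normal k (adjoin k (p.rootSet Ω)) := Normal.of_isSplittingField p
  exact {}

theorem finiteDimensional_adjoin_rootSet [IsAlgClosed Ω] (p : k[X]) :
    FiniteDimensional k (adjoin k (p.rootSet Ω)) := by
  have := adjoin_rootSet_isSplittingField (IsAlgClosed.splits (p.map (algebraMap k Ω)))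
  exact IsSplittingField.finiteDimensional _ p

theorem exists_algEquiv_perm {x : Fin 4 → Ω}
    (τ₁ τ₂ : Gal(Ω/k)) (h₁ : ∀ i, τ₁ (x i) = x (swap 0 1 i))
    (h₂ : ∀ i, τ₂ (x i) = x (threeCycle i)) (σ : Perm (Fin 4)) :
    ∃ τ : Gal(Ω/k), ∀ i, τ (x i) = x (σ i) := by
  let H : Subgroup (Perm (Fin 4)) :=
    { carrier := {σ | ∃ τ : Gal(Ω/k), ∀ i, τ (x i) = x (σ i)}
      one_mem' := ⟨1, fun i => rfl⟩
      mul_mem' := by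
        rintro σ σ' ⟨τ, hτ⟩ ⟨τ', hτ'⟩
        exact ⟨τ * τ', fun i => by rw [AlgEquiv.mul_apply, hτ', hτ, Perm.mul_apply]⟩
      inv_mem' := by
        rintro σ ⟨τ, hτ⟩
        refine ⟨τ⁻¹, fun i => τ.injective ?_⟩
        rw [hτ, ← Perm.mul_apply, mul_inv_cancel, ← AlgEquiv.mul_apply, mul_inv_cancel]
        rfl }
  have : H = ⊤ := Subgroup.eq_top_of_swap_of_threeCycle H ⟨τ₁, h₁⟩ ⟨τ₂, h₂⟩
  exact (this ▸ Subgroup.mem_top σ : σ ∈ H)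

/-- A quartic whose roots are not all equal and are permuted by automorphisms through a
transposition and a 3-cycle generating `S₄` has Galois group `S₄`. -/
theorem galois_s4_of_perm [IsAlgClosed Ω] [PerfectField k] {x : Fin 4 → Ω} {p : k[X]}
    (hp : p.map (algebraMap k Ω) = ∏ i, (X - C (x i))) (hne : ∃ i j, x i ≠ x j)
    (τ₁ τ₂ : Gal(Ω/k)) (h₁ : ∀ i, τ₁ (x i) = x (swap 0 1 i))
    (h₂ : ∀ i, τ₂ (x i) = x (threeCycle i)) :
    Nonempty (Gal(adjoin k (p.rootSet Ω)/k) ≃* Perm (Fin 4)) := by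
  have := isGalois_adjoin_rootSet (Ω := Ω) p
  have hex := exists_algEquiv_perm τ₁ τ₂ h₁ h₂
  -- S₄ is doubly transitive, so one coincidence between roots would force all of them to be equal.
  have hx : Function.Injective x := by
    intro i j hij
    by_contra hne'
    obtain ⟨m, l, hkl⟩ := hne
    have hkl' : m ≠ l := fun h => hkl (h ▸ rfl)
    obtain ⟨σ, rfl, rfl⟩ := (by decide +kernel : ∀ i j k l : Fin 4, i ≠ j → k ≠ l →
      ∃ σ : Perm (Fin 4), σ i = k ∧ σ j = l) i j m l hne' hkl'
    obtain ⟨τ, hτ⟩ := hex σ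
    exact hkl (by rw [← hτ, ← hτ, hij])
  have hroot := rootSet_eq_range hp
  have hmem : ∀ i, x i ∈ p.rootSet Ω := fun i => hroot ▸ Set.mem_range_self i
  let c : Fin 4 → adjoin k (p.rootSet Ω) := fun i => ⟨x i, subset_adjoin _ _ (hmem i)⟩
  have hc : Function.Injective c := fun i j h => hx (congrArg Subtype.val h)
  have hp0 : p ≠ 0 := by
    rintro rfl
    simpa using hmem 0
  obtain ⟨ψ, hψ⟩ := exists_permHom (A := Gal(adjoin k (p.rootSet Ω)/k)) c hc (by
    intro g i
    have h : ((adjoin k (p.rootSet Ω)).val.comp g.toAlgHom) (c i) ∈ p.rootSet Ω := by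
      have h0 := hmem i
      rw [mem_rootSet_of_ne hp0] at h0 ⊢
      have : aeval (c i) p = 0 := by
        apply (adjoin k (p.rootSet Ω)).val.injective
        rw [map_zero]
        exact (aeval_algHom_apply (adjoin k (p.rootSet Ω)).val (c i) p).symm.trans h0
      refine (aeval_algHom_apply ((adjoin k (p.rootSet Ω)).val.comp g.toAlgHom) (c i) p).trans ?_
      rw [this, map_zero]
    obtain ⟨j, hj⟩ := hroot.subset h
    exact ⟨j, Subtype.ext hj.symm⟩)
  refine ⟨MulEquiv.ofBijective ψ ⟨?_, ?_⟩⟩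
  · rw [injective_iff_map_eq_one]
    intro g hg
    have hfix : ∀ i, g (c i) = c i := fun i => by
      have := hψ g i
      rwa [hg] at this
    have : g.toAlgHom = AlgHom.id k _ := by
      refine adjoin_algHom_ext k ?_
      intro y hy
      obtain ⟨i, rfl⟩ := hroot ▸ hy
      exact hfix i
    exact AlgEquiv.ext fun y => DFunLike.congr_fun this y
  · intro σ
    obtain ⟨τ, hτ⟩ := hex σ
    refine ⟨AlgEquiv.restrictNormal τ (adjoin k (p.rootSet Ω)), Equiv.ext fun i => hc ?_⟩
    rw [← hψ]
    apply Subtype.ext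
    exact (AlgEquiv.restrictNormal_commutes τ (adjoin k (p.rootSet Ω)) (c i)).trans (hτ i)

end GaloisTheory

/-! ### Automorphisms as signed permutations -/

section SignedPermutations

open Equiv (Perm swap)
open IntermediateField

/-- The group of signed permutations of four letters whose signs multiply to the sign of the
underlying permutation. -/
abbrev SignedPerm : Type :=
  {s : Perm (Fin 4) × (Fin 4 → ℤˣ) // ∏ i, s.2 i = Perm.sign s.1}

theorem card_signedPerm : Fintype.card SignedPerm = 192 := by decide +kernel

variable {k Ω : Type*} [Field k] [Field Ω] [Algebra k Ω]

/-- An embedding multiplies ∏ tᵢ by the product of the signs and the Vandermonde determinant by sign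
σ; proportionality of the two makes these factors equal. -/
theorem exists_signedPerm [CharZero Ω] {A : Type*} [Field A] [Algebra k A]
    {l t : Fin 4 → Ω} {l' t' : Fin 4 → A} (ht : ∀ i, t i ≠ 0)
    {g Y : k[X]} (hg : g.map (algebraMap k Ω) = ∏ i, (X - C (l i)))
    (hg' : g.map (algebraMap k A) = ∏ i, (X - C (l' i))) (hl' : Function.Injective l')
    (hY : ∀ i, t i ^ 2 = aeval (l i) Y) (hY' : ∀ i, t' i ^ 2 = aeval (l' i) Y)
    (c : k) (hD : ∏ i, t i = algebraMap k Ω c * (Matrix.vandermonde l).det)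
    (hD' : ∏ i, t' i = algebraMap k A c * (Matrix.vandermonde l').det) (φ : A →ₐ[k] Ω) :
    ∃ s : SignedPerm, (∀ i, φ (l' i) = l (s.1.1 i)) ∧
      ∀ i, φ (t' i) = ((s.1.2 i : ℤ) : Ω) * t (s.1.1 i) := by
  have hex : ∀ i, ∃ j, φ (l' i) = l j := by
    intro i
    have h0 : (g.map (algebraMap k A)).eval (l' i) = 0 := by
      rw [hg', eval_prod]
      exact Finset.prod_eq_zero (Finset.mem_univ i) (by simp)
    rw [eval_map, ← aeval_def] at h0
    have h1 : (g.map (algebraMap k Ω)).eval (φ (l' i)) = 0 := by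
      rw [eval_map, ← aeval_def, aeval_algHom_apply, h0, map_zero]
    rw [hg, eval_prod, Finset.prod_eq_zero_iff] at h1
    obtain ⟨j, -, hj⟩ := h1
    exact ⟨j, by simpa [sub_eq_zero] using hj⟩
  choose f hf using hex
  have hfinj : Function.Injective f := fun i j hij =>
    hl' (φ.injective ((hf i).trans ((congrArg l hij).trans (hf j).symm)))
  let σ : Perm (Fin 4) := Equiv.ofBijective f (Finite.injective_iff_bijective.1 hfinj)
  have hσ : ∀ i, φ (l' i) = l (σ i) := hf
  have hsign : ∀ i, ∃ e : ℤˣ, φ (t' i) = ((e : ℤ) : Ω) * t (σ i) := by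
    intro i
    have : φ (t' i) ^ 2 = t (σ i) ^ 2 := by
      rw [← map_pow, hY', ← aeval_algHom_apply, hσ, hY]
    rcases sq_eq_sq_iff_eq_or_eq_neg.1 this with h | h
    · exact ⟨1, by simp [h]⟩
    · exact ⟨-1, by simp [h]⟩
  choose ε hε using hsign
  refine ⟨⟨(σ, ε), ?_⟩, hσ, hε⟩
  have h1 : φ (∏ i, t' i) = (∏ i, ((ε i : ℤ) : Ω)) * ∏ i, t i := by
    rw [map_prod, Finset.prod_congr rfl fun i _ => hε i, Finset.prod_mul_distrib,
      Equiv.prod_comp σ t]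
  have h2 : φ (∏ i, t' i) = ((Perm.sign σ : ℤ) : Ω) * ∏ i, t i := by
    have hm : φ.mapMatrix (Matrix.vandermonde l') = (Matrix.vandermonde l).submatrix σ id := by
      ext i j
      simp [Matrix.vandermonde_apply, hσ]
    rw [hD', map_mul, AlgHom.commutes, AlgHom.map_det, hm, Matrix.det_permute, hD]
    ring
  have h3 : (∏ i, ((ε i : ℤ) : Ω)) = ((Perm.sign σ : ℤ) : Ω) :=
    mul_right_cancel₀ (Finset.prod_ne_zero_iff.2 fun i _ => ht i) (h1.symm.trans h2)
  ext
  have : ((∏ i, (ε i : ℤ) : ℤ) : Ω) = ((Perm.sign σ : ℤ) : Ω) := by rw [← h3]; push_cast; rfl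
  have := Int.cast_injective this
  rw [← this]
  push_cast
  rfl

/-- If a field of degree at least `192` is generated by the roots `l i` of a quartic and by square
roots `t i` of `Y (l i)`, whose product is a rational multiple of the Vandermonde determinant, then
every signed permutation in `SignedPerm` is induced by an automorphism. -/
theorem exists_algEquiv_signedPerm [CharZero Ω] [PerfectField k] [IsAlgClosed Ω]
    [Algebra.IsAlgebraic k Ω]
    {l t : Fin 4 → Ω} (hl : Function.Injective l) (ht : ∀ i, t i ≠ 0)
    {g Y : k[X]} (hg : g.map (algebraMap k Ω) = ∏ i, (X - C (l i)))
    (hY : ∀ i, t i ^ 2 = aeval (l i) Y)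
    (c : k) (hD : ∏ i, t i = algebraMap k Ω c * (Matrix.vandermonde l).det)
    {L : IntermediateField k Ω} (hL : L ≤ adjoin k (Set.range l ∪ Set.range t))
    (hrank : 192 ≤ Module.finrank k L) :
    L = adjoin k (Set.range l ∪ Set.range t) ∧
    ∀ s : SignedPerm, ∃ τ : Gal(Ω/k), (∀ i, τ (l i) = l (s.1.1 i)) ∧
      ∀ i, τ (t i) = ((s.1.2 i : ℤ) : Ω) * t (s.1.1 i) := by
  set M := adjoin k (Set.range l ∪ Set.range t) with hM
  have hfin : FiniteDimensional k M :=
    have : Finite ↑(Set.range l ∪ Set.range t) :=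
      ((Set.finite_range l).union (Set.finite_range t)).to_subtype
    finiteDimensional_adjoin fun x _ => Algebra.IsIntegral.isIntegral x
  have hlM : ∀ i, l i ∈ M := fun i => subset_adjoin _ _ (Or.inl ⟨i, rfl⟩)
  have htM : ∀ i, t i ∈ M := fun i => subset_adjoin _ _ (Or.inr ⟨i, rfl⟩)
  let l' : Fin 4 → M := fun i => ⟨l i, hlM i⟩
  let t' : Fin 4 → M := fun i => ⟨t i, htM i⟩
  have hg' : g.map (algebraMap k M) = ∏ i, (X - C (l' i)) := by
    apply Polynomial.map_injective (algebraMap M Ω) (algebraMap M Ω).injective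
    rw [Polynomial.map_map, ← IsScalarTower.algebraMap_eq, hg, Polynomial.map_prod]
    simp [l']
  have hY' : ∀ i, t' i ^ 2 = aeval (l' i) Y := fun i => M.val.injective (by
    rw [map_pow]
    exact (hY i).trans (aeval_algHom_apply M.val (l' i) Y))
  have hD' : ∏ i, t' i = algebraMap k M c * (Matrix.vandermonde l').det := by
    apply M.val.injective
    change M.val _ = M.val _
    have hm : M.val.mapMatrix (Matrix.vandermonde l') = Matrix.vandermonde l := by
      ext i j
      simp [Matrix.vandermonde_apply, l']
    rw [map_mul, AlgHom.commutes, AlgHom.map_det, hm, ← hD, map_prod]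
    rfl
  have key := exists_signedPerm (A := M) ht hg hg'
    (fun i j h => hl (congrArg Subtype.val h)) hY hY' c hD hD'
  choose F hF₁ hF₂ using key
  have hFinj : Function.Injective F := by
    intro φ φ' h
    refine adjoin_algHom_ext k ?_
    rintro x (⟨i, rfl⟩ | ⟨i, rfl⟩)
    · exact (hF₁ φ i).trans (by rw [h, ← hF₁ φ' i])
    · exact (hF₂ φ i).trans (by rw [h, ← hF₂ φ' i])
  have hcard : Fintype.card (M →ₐ[k] Ω) = Module.finrank k M := AlgHom.card k M Ω
  have hle := Fintype.card_le_of_injective F hFinj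
  rw [card_signedPerm, hcard] at hle
  -- An embedding of M is determined by its signed permutation, so [M : k] ≤ 192 ≤ [L : k].
  have hLM : L = M := eq_of_le_of_finrank_le hL (hle.trans hrank)
  refine ⟨hLM, fun s => ?_⟩
  have hsurj : Function.Surjective F := by
    refine ((Fintype.bijective_iff_injective_and_card F).2 ⟨hFinj, ?_⟩).2
    rw [card_signedPerm, hcard]
    exact le_antisymm hle (hLM ▸ hrank)
  obtain ⟨φ, rfl⟩ := hsurj s
  obtain ⟨ψ, hψ⟩ := IsAlgClosed.surjective_domRestrict_of_isAlgebraic (K := k) (L := M) (E := Ω) φ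
  have hψ' : ∀ x : M, ψ x = φ x := fun x => DFunLike.congr_fun hψ x
  refine ⟨(Algebra.IsAlgebraic.algEquivEquivAlgHom k Ω).symm ψ, fun i => ?_, fun i => ?_⟩
  · exact (hψ' (l' i)).trans (hF₁ φ i)
  · exact (hψ' (t' i)).trans (hF₂ φ i)

end SignedPermutations

/-! ### Tangent slopes and the coefficients of E and h₃ -/

section Identities

variable {F : Type*} [Field F]

/-- `l₀, l₁, l₂, l₃` are the slopes of the lines through `-P`, `P = (z, w)`, that are tangent to
`y² = x³ + a x + b`: the roots of `l⁴ - 6 z l² - 8 w l - 3 z² - 4 a`. -/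
structure IsTangentSlopes (a b z w l₀ l₁ l₂ l₃ : F) : Prop where
  sum : l₃ = -(l₀ + l₁ + l₂)
  esymm₂ : l₀ * l₁ + l₀ * l₂ + l₀ * l₃ + l₁ * l₂ + l₁ * l₃ + l₂ * l₃ = -6 * z
  esymm₃ : l₁ * l₂ * l₃ + l₀ * l₂ * l₃ + l₀ * l₁ * l₃ + l₀ * l₁ * l₂ = 8 * w
  esymm₄ : l₀ * l₁ * l₂ * l₃ = -3 * z ^ 2 - 4 * a
  curve : b = w ^ 2 - z ^ 3 - a * z

theorem IsAlgClosed.exists_quadratic_root [IsAlgClosed F] (b c : F) :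
    ∃ x : F, x ^ 2 + b * x + c = 0 := by
  obtain ⟨x, hx⟩ := IsAlgClosed.exists_root (X ^ 2 + C b * X + C c : F[X])
    (by rw [show (X ^ 2 + C b * X + C c : F[X]).degree = 2 by compute_degree!]; decide)
  exact ⟨x, by simpa using hx⟩

theorem IsAlgClosed.exists_cubic_root [IsAlgClosed F] (a b c : F) :
    ∃ x : F, x ^ 3 + a * x ^ 2 + b * x + c = 0 := by
  obtain ⟨x, hx⟩ := IsAlgClosed.exists_root (X ^ 3 + C a * X ^ 2 + C b * X + C c : F[X])
    (by rw [show (X ^ 3 + C a * X ^ 2 + C b * X + C c : F[X]).degree = 3 by compute_degree!]; decide)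
  exact ⟨x, by simpa using hx⟩

theorem IsAlgClosed.exists_depressed_quartic_root [IsAlgClosed F] (a b c : F) :
    ∃ x : F, x ^ 4 + a * x ^ 2 + b * x + c = 0 := by
  obtain ⟨x, hx⟩ := IsAlgClosed.exists_root (X ^ 4 + C a * X ^ 2 + C b * X + C c : F[X])
    (by rw [show (X ^ 4 + C a * X ^ 2 + C b * X + C c : F[X]).degree = 4 by compute_degree!]; decide)
  exact ⟨x, by simpa using hx⟩

theorem exists_isTangentSlopes [IsAlgClosed F] {a b z w : F}
    (h : b = w ^ 2 - z ^ 3 - a * z) : ∃ l₀ l₁ l₂ l₃, IsTangentSlopes a b z w l₀ l₁ l₂ l₃ := by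
  obtain ⟨l₀, h₀⟩ := IsAlgClosed.exists_depressed_quartic_root (-6 * z) (-8 * w) (-3 * z ^ 2 - 4 * a)
  -- The cubic is the quartic divided by x - l₀, and the quadratic below is the cubic divided by x -
  -- l₁.
  obtain ⟨l₁, h₁⟩ := IsAlgClosed.exists_cubic_root l₀ (l₀ ^ 2 - 6 * z) (l₀ ^ 3 - 6 * z * l₀ - 8 * w)
  obtain ⟨l₂, h₂⟩ := IsAlgClosed.exists_quadratic_root (l₀ + l₁) (l₀ ^ 2 + l₀ * l₁ + l₁ ^ 2 - 6 * z)
  refine ⟨l₀, l₁, l₂, -(l₀ + l₁ + l₂), rfl, ?_, ?_, ?_, h⟩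
  · linear_combination -h₂
  · linear_combination h₁ - (l₀ + l₁) * h₂
  · linear_combination -h₀ + l₀ * h₁ - l₀ * l₁ * h₂

namespace IsTangentSlopes

variable {a b z w l₀ l₁ l₂ l₃ : F}

theorem quartic_eq (h : IsTangentSlopes a b z w l₀ l₁ l₂ l₃) (x : F) :
    x ^ 4 - 6 * z * x ^ 2 - 8 * w * x - 3 * z ^ 2 - 4 * a =
      (x - l₀) * (x - l₁) * (x - l₂) * (x - l₃) := by
  linear_combination -x ^ 2 * h.esymm₂ + x * h.esymm₃ - h.esymm₄ + x ^ 3 * h.sum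

variable [CharZero F]

/-- Behind this and the next formulas: (l₀ + lᵢ)² = 4(z - eᵢ), where the eᵢ are the roots of x³ + ax
+ b. -/
theorem z_eq (h : IsTangentSlopes a b z w l₀ l₁ l₂ l₃) :
    z = ((l₀ + l₁) ^ 2 + (l₀ + l₂) ^ 2 + (l₀ + l₃) ^ 2) / 12 := by
  have h₂ := h.esymm₂
  rw [h.sum] at h₂ ⊢
  linear_combination h₂ / 6

theorem w_eq (h : IsTangentSlopes a b z w l₀ l₁ l₂ l₃) :
    w = (l₀ + l₁) * (l₀ + l₂) * (l₀ + l₃) / 8 := by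
  have h₂ := h.esymm₃
  rw [h.sum] at h₂ ⊢
  linear_combination -h₂ / 8

theorem a_eq (h : IsTangentSlopes a b z w l₀ l₁ l₂ l₃) :
    a = ((l₀ + l₁) ^ 2 * (l₀ + l₂) ^ 2 + (l₀ + l₂) ^ 2 * (l₀ + l₃) ^ 2 +
      (l₀ + l₃) ^ 2 * (l₀ + l₁) ^ 2) / 16 - 3 * z ^ 2 := by
  have h₂ := h.esymm₂
  have h₄ := h.esymm₄
  rw [h.sum] at h₂ h₄ ⊢
  have hz : z = (l₀ ^ 2 + l₁ ^ 2 + l₂ ^ 2 + l₀ * l₁ + l₀ * l₂ + l₁ * l₂) / 6 := by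
    linear_combination h₂ / 6
  have ha : a = -(l₀ * l₁ * l₂ * -(l₀ + l₁ + l₂)) / 4 - 3 / 4 * z ^ 2 := by
    linear_combination h₄ / 4
  rw [ha, hz]
  ring

/-- Each (lᵢ - lⱼ)(lₘ - lₙ) is, up to sign, 4 times a difference of two eᵢ, and d = -∏(eᵢ - eⱼ)²;
hence 4096 = 64². -/
theorem d_eq (h : IsTangentSlopes a b z w l₀ l₁ l₂ l₃) :
    4 * a ^ 3 + 27 * b ^ 2 =
      -((l₀ - l₁) * (l₂ - l₃) * ((l₀ - l₂) * (l₃ - l₁)) * ((l₀ - l₃) * (l₁ - l₂))) ^ 2 / 4096 := by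
  have e₁ : (l₀ - l₁) * (l₂ - l₃) = (l₀ + l₂) ^ 2 - (l₀ + l₃) ^ 2 := by rw [h.sum]; ring
  have e₂ : (l₀ - l₂) * (l₃ - l₁) = (l₀ + l₃) ^ 2 - (l₀ + l₁) ^ 2 := by rw [h.sum]; ring
  have e₃ : (l₀ - l₃) * (l₁ - l₂) = (l₀ + l₁) ^ 2 - (l₀ + l₂) ^ 2 := by rw [h.sum]; ring
  have hw : w ^ 2 = (l₀ + l₁) ^ 2 * (l₀ + l₂) ^ 2 * (l₀ + l₃) ^ 2 / 64 := by rw [h.w_eq]; ring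
  rw [e₁, e₂, e₃, h.curve, h.a_eq, hw, h.z_eq]
  generalize (l₀ + l₁) ^ 2 = u
  generalize (l₀ + l₂) ^ 2 = v
  generalize (l₀ + l₃) ^ 2 = s
  ring

/-- The value at `l` of `(l³ - 3 z l - 2 w) / 2`, the `y`-coordinate of the tangency point. -/
theorem y_eq (h : IsTangentSlopes a b z w l₀ l₁ l₂ l₃) :
    (l₀ ^ 3 - 3 * z * l₀ - 2 * w) / 2 = (l₀ - l₁) * (l₀ - l₂) * (l₀ - l₃) / 8 ∧
    (l₁ ^ 3 - 3 * z * l₁ - 2 * w) / 2 = (l₁ - l₀) * (l₁ - l₂) * (l₁ - l₃) / 8 ∧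
    (l₂ ^ 3 - 3 * z * l₂ - 2 * w) / 2 = (l₂ - l₀) * (l₂ - l₁) * (l₂ - l₃) / 8 ∧
    (l₃ ^ 3 - 3 * z * l₃ - 2 * w) / 2 = (l₃ - l₀) * (l₃ - l₁) * (l₃ - l₂) / 8 := by
  refine ⟨?_, ?_, ?_, ?_⟩ <;> rw [h.w_eq, h.z_eq, h.sum] <;> ring

theorem h3_eq (h : IsTangentSlopes a b z w l₀ l₁ l₂ l₃) (x : F) :
    x ^ 4 - 8 * w * x ^ 3 + 6 * (2 * a * z + 3 * b) * x ^ 2 - (4 * a ^ 3 + 27 * b ^ 2) =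
      (x - (l₀ ^ 3 - 3 * z * l₀ - 2 * w) / 2) * (x - (l₁ ^ 3 - 3 * z * l₁ - 2 * w) / 2) *
      (x - (l₂ ^ 3 - 3 * z * l₂ - 2 * w) / 2) * (x - (l₃ ^ 3 - 3 * z * l₃ - 2 * w) / 2) := by
  obtain ⟨e₀, e₁, e₂, e₃⟩ := h.y_eq
  rw [e₀, e₁, e₂, e₃, h.d_eq, h.curve, h.a_eq, h.z_eq, h.w_eq, h.sum]
  ring

end IsTangentSlopes
end Identities

/-! ### Roots of h₁ and h₂ -/

section Identities

variable {F : Type*} [Field F]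

/-- Only X², Y², Z² and XYZ enter the coefficients, so the square roots matter only through their
product. -/
theorem quartet_prod (x X Y Z : F) :
    (x - (X + Y + Z)) * (x - (X - Y - Z)) * (x - (-X + Y - Z)) * (x - (-X - Y + Z)) =
      x ^ 4 - 2 * (X ^ 2 + Y ^ 2 + Z ^ 2) * x ^ 2 - 8 * (X * Y * Z) * x +
        ((X ^ 2 + Y ^ 2 + Z ^ 2) ^ 2 - 4 * (X ^ 2 * Y ^ 2 + Y ^ 2 * Z ^ 2 + Z ^ 2 * X ^ 2)) := by
  ring

namespace IsTangentSlopes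

variable {a b z w l₀ l₁ l₂ l₃ : F}

theorem differences (h : IsTangentSlopes a b z w l₀ l₁ l₂ l₃) :
    (l₀ - l₁) * (l₂ - l₃) = (l₀ + l₂) ^ 2 - (l₀ + l₃) ^ 2 ∧
    (l₀ - l₂) * (l₃ - l₁) = (l₀ + l₃) ^ 2 - (l₀ + l₁) ^ 2 ∧
    (l₀ - l₃) * (l₁ - l₂) = (l₀ + l₁) ^ 2 - (l₀ + l₂) ^ 2 := by
  refine ⟨?_, ?_, ?_⟩ <;> rw [h.sum] <;> ring

variable {t₀ t₁ t₂ t₃ : F} [CharZero F]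

/-- The elementary symmetric functions of the squares behind the roots of `h₁` and `h₂`. -/
theorem resolvent_coeffs (h : IsTangentSlopes a b z w l₀ l₁ l₂ l₃) {X Y Z : F}
    (hX : X ^ 2 = (l₀ - l₁) * (l₂ - l₃) * ((l₀ - l₂) * (l₃ - l₁)) * ((l₀ - l₃) * (l₁ - l₂)) *
      ((l₀ - l₁) * (l₂ - l₃)) / 16)
    (hY : Y ^ 2 = (l₀ - l₁) * (l₂ - l₃) * ((l₀ - l₂) * (l₃ - l₁)) * ((l₀ - l₃) * (l₁ - l₂)) *
      ((l₀ - l₂) * (l₃ - l₁)) / 16)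
    (hZ : Z ^ 2 = (l₀ - l₁) * (l₂ - l₃) * ((l₀ - l₂) * (l₃ - l₁)) * ((l₀ - l₃) * (l₁ - l₂)) *
      ((l₀ - l₃) * (l₁ - l₂)) / 16)
    (hXYZ : X * Y * Z =
      ((l₀ - l₁) * (l₂ - l₃) * ((l₀ - l₂) * (l₃ - l₁)) * ((l₀ - l₃) * (l₁ - l₂))) ^ 2 / 64)
    (d : F) (hd : d = 4 * a ^ 3 + 27 * b ^ 2) :
    2 * ((X * (l₀ + l₁) ^ 2) ^ 2 + (Y * (l₀ + l₂) ^ 2) ^ 2 + (Z * (l₀ + l₃) ^ 2) ^ 2) = 512 * d ∧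
    8 * ((X * (l₀ + l₁) ^ 2) * (Y * (l₀ + l₂) ^ 2) * (Z * (l₀ + l₃) ^ 2)) =
      -(2 ^ 15 * d * w ^ 2) ∧
    ((X * (l₀ + l₁) ^ 2) ^ 2 + (Y * (l₀ + l₂) ^ 2) ^ 2 + (Z * (l₀ + l₃) ^ 2) ^ 2) ^ 2 -
      4 * ((X * (l₀ + l₁) ^ 2) ^ 2 * (Y * (l₀ + l₂) ^ 2) ^ 2 +
        (Y * (l₀ + l₂) ^ 2) ^ 2 * (Z * (l₀ + l₃) ^ 2) ^ 2 +
        (Z * (l₀ + l₃) ^ 2) ^ 2 * (X * (l₀ + l₁) ^ 2) ^ 2) =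
      2 ^ 16 * d * (d + w ^ 2 * (12 * a * z - 36 * b)) +
        2 ^ 18 * d * (27 * b * z ^ 3 - 9 * a ^ 2 * z ^ 2 - a ^ 3) ∧
    2 * ((X * ((l₀ + l₂) * (l₀ + l₃))) ^ 2 + (Y * ((l₀ + l₁) * (l₀ + l₃))) ^ 2 +
      (Z * ((l₀ + l₁) * (l₀ + l₂))) ^ 2) = 512 * d ∧
    8 * ((X * ((l₀ + l₂) * (l₀ + l₃))) * (Y * ((l₀ + l₁) * (l₀ + l₃))) *
      (Z * ((l₀ + l₁) * (l₀ + l₂)))) = -(2 ^ 15 * d * w ^ 2) ∧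
    ((X * ((l₀ + l₂) * (l₀ + l₃))) ^ 2 + (Y * ((l₀ + l₁) * (l₀ + l₃))) ^ 2 +
      (Z * ((l₀ + l₁) * (l₀ + l₂))) ^ 2) ^ 2 -
      4 * ((X * ((l₀ + l₂) * (l₀ + l₃))) ^ 2 * (Y * ((l₀ + l₁) * (l₀ + l₃))) ^ 2 +
        (Y * ((l₀ + l₁) * (l₀ + l₃))) ^ 2 * (Z * ((l₀ + l₁) * (l₀ + l₂))) ^ 2 +
        (Z * ((l₀ + l₁) * (l₀ + l₂))) ^ 2 * (X * ((l₀ + l₂) * (l₀ + l₃))) ^ 2) =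
      2 ^ 16 * d * (d + w ^ 2 * (12 * a * z - 36 * b)) := by
  have hd' := hd.trans h.d_eq
  obtain ⟨e₁, e₂, e₃⟩ := h.differences
  have hw : w ^ 2 = (l₀ + l₁) ^ 2 * (l₀ + l₂) ^ 2 * (l₀ + l₃) ^ 2 / 64 := by rw [h.w_eq]; ring
  have hz := h.z_eq
  have ha := h.a_eq
  have hb := h.curve
  rw [e₁, e₂, e₃] at hX hY hZ hXYZ hd'
  simp only [mul_pow]
  have m₁ : ∀ U V W : F, 8 * (X * U * (Y * V) * (Z * W)) = 8 * (X * Y * Z) * (U * V * W) := by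
    intros; ring
  have m₂ : (l₀ + l₂) * (l₀ + l₃) * ((l₀ + l₁) * (l₀ + l₃)) * ((l₀ + l₁) * (l₀ + l₂)) =
    (l₀ + l₁) ^ 2 * (l₀ + l₂) ^ 2 * (l₀ + l₃) ^ 2 := by ring
  rw [m₁, m₁, m₂, hXYZ, hX, hY, hZ, hw]
  rw [hw] at hb
  -- Only the squares of the pair sums remain, so the identities hold in three free variables.
  generalize (l₀ + l₁) ^ 2 = u at *
  generalize (l₀ + l₂) ^ 2 = v at *
  generalize (l₀ + l₃) ^ 2 = s at *
  rw [hz] at ha hb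
  rw [ha] at hb
  rw [hb, ha, hz, hd']
  refine ⟨?_, ?_, ?_, ?_, ?_, ?_⟩ <;> ring

/-- Squares of the building blocks `2 t₀ tᵢ (lⱼ - lₖ)` of the roots of `h₁` and `h₂`. -/
theorem blocks (h : IsTangentSlopes a b z w l₀ l₁ l₂ l₃)
    (h₀ : t₀ ^ 2 = (l₀ ^ 3 - 3 * z * l₀ - 2 * w) / 2)
    (h₁ : t₁ ^ 2 = (l₁ ^ 3 - 3 * z * l₁ - 2 * w) / 2)
    (h₂ : t₂ ^ 2 = (l₂ ^ 3 - 3 * z * l₂ - 2 * w) / 2)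
    (h₃ : t₃ ^ 2 = (l₃ ^ 3 - 3 * z * l₃ - 2 * w) / 2)
    (ht : t₀ * t₁ * t₂ * t₃ =
      (l₀ - l₁) * (l₂ - l₃) * ((l₀ - l₂) * (l₃ - l₁)) * ((l₀ - l₃) * (l₁ - l₂)) / 64) :
    (2 * t₀ * t₁ * (l₂ - l₃)) ^ 2 =
      (l₀ - l₁) * (l₂ - l₃) * ((l₀ - l₂) * (l₃ - l₁)) * ((l₀ - l₃) * (l₁ - l₂)) *
      ((l₀ - l₁) * (l₂ - l₃)) / 16 ∧
    (2 * t₀ * t₂ * (l₃ - l₁)) ^ 2 =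
      (l₀ - l₁) * (l₂ - l₃) * ((l₀ - l₂) * (l₃ - l₁)) * ((l₀ - l₃) * (l₁ - l₂)) *
      ((l₀ - l₂) * (l₃ - l₁)) / 16 ∧
    (2 * t₀ * t₃ * (l₁ - l₂)) ^ 2 =
      (l₀ - l₁) * (l₂ - l₃) * ((l₀ - l₂) * (l₃ - l₁)) * ((l₀ - l₃) * (l₁ - l₂)) *
      ((l₀ - l₃) * (l₁ - l₂)) / 16 ∧
    2 * t₀ * t₁ * (l₂ - l₃) * (2 * t₀ * t₂ * (l₃ - l₁)) * (2 * t₀ * t₃ * (l₁ - l₂)) =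
      ((l₀ - l₁) * (l₂ - l₃) * ((l₀ - l₂) * (l₃ - l₁)) * ((l₀ - l₃) * (l₁ - l₂))) ^ 2 / 64 := by
  obtain ⟨e₀, e₁, e₂, e₃⟩ := h.y_eq
  rw [e₀] at h₀
  rw [e₁] at h₁
  rw [e₂] at h₂
  rw [e₃] at h₃
  refine ⟨?_, ?_, ?_, ?_⟩
  · simp only [mul_pow, h₀, h₁]; ring
  · simp only [mul_pow, h₀, h₂]; ring
  · simp only [mul_pow, h₀, h₃]; ring
  · calc _ = 8 * t₀ ^ 2 * (t₀ * t₁ * t₂ * t₃) * ((l₂ - l₃) * (l₃ - l₁) * (l₁ - l₂)) := by ring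
      _ = _ := by rw [h₀, ht]; ring

/-- Multiplying by t₀t₂ or t₀t₃ leaves only ∏ tᵢ and squares, all known in the slopes. The relations
bring a block moved by an automorphism off t₀ back to one containing t₀. -/
theorem block_relations (h : IsTangentSlopes a b z w l₀ l₁ l₂ l₃)
    (h₀ : t₀ ^ 2 = (l₀ ^ 3 - 3 * z * l₀ - 2 * w) / 2)
    (h₂ : t₂ ^ 2 = (l₂ ^ 3 - 3 * z * l₂ - 2 * w) / 2)
    (h₃ : t₃ ^ 2 = (l₃ ^ 3 - 3 * z * l₃ - 2 * w) / 2)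
    (n₀ : t₀ ≠ 0) (n₂ : t₂ ≠ 0) (n₃ : t₃ ≠ 0)
    (ht : t₀ * t₁ * t₂ * t₃ =
      (l₀ - l₁) * (l₂ - l₃) * ((l₀ - l₂) * (l₃ - l₁)) * ((l₀ - l₃) * (l₁ - l₂)) / 64) :
    t₁ * t₃ * (l₀ - l₂) = t₀ * t₂ * (l₃ - l₁) ∧
    t₁ * t₂ * (l₀ - l₃) = t₀ * t₃ * (l₁ - l₂) := by
  obtain ⟨e₀, -, e₂, e₃⟩ := h.y_eq
  rw [e₀] at h₀
  rw [e₂] at h₂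
  rw [e₃] at h₃
  refine ⟨?_, ?_⟩
  · apply mul_left_cancel₀ (mul_ne_zero n₀ n₂)
    calc _ = t₀ * t₁ * t₂ * t₃ * (l₀ - l₂) := by ring
      _ = t₀ ^ 2 * t₂ ^ 2 * (l₃ - l₁) := by rw [ht, h₀, h₂]; ring
      _ = _ := by ring
  · apply mul_left_cancel₀ (mul_ne_zero n₀ n₃)
    calc _ = t₀ * t₁ * t₂ * t₃ * (l₀ - l₃) := by ring
      _ = t₀ ^ 2 * t₃ ^ 2 * (l₁ - l₂) := by rw [ht, h₀, h₃]; ring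
      _ = _ := by ring

end IsTangentSlopes
end Identities

/-! ### The doubling formula -/

section Halving

open WeierstrassCurve

theorem two_nsmul_some_eq_iff {F : Type*} [Field F] [CharZero F] [DecidableEq F]
    {W : WeierstrassCurve F} (h₁ : W.a₁ = 0) (h₂ : W.a₂ = 0) (h₃ : W.a₃ = 0) {x y z w : F}
    (hQ : W.toAffine.Nonsingular x y) (hP : W.toAffine.Nonsingular z w) :
    2 • Affine.Point.some x y hQ = Affine.Point.some z w hP ↔
      y ≠ 0 ∧ ∃ l, 2 * y * l = 3 * x ^ 2 + W.a₄ ∧ z = l ^ 2 - 2 * x ∧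
        w = -(l * (z - x) + y) := by
  rw [two_nsmul]
  have hneg : W.toAffine.negY x y = -y := by simp [Affine.negY, h₁, h₃]
  by_cases hy : y = 0
  · have : y = W.toAffine.negY x y := by rw [hneg, hy, neg_zero]
    rw [Affine.Point.add_self_of_Y_eq this]
    simp [hy, (Affine.Point.some_ne_zero hP).symm]
  · have hy' : y ≠ W.toAffine.negY x y := by
      rw [hneg]
      intro h
      exact hy (self_eq_neg.1 h)
    rw [Affine.Point.add_self_of_Y_ne hy', Affine.Point.some.injEq]
    have hs : 2 * y * W.toAffine.slope x x y y = 3 * x ^ 2 + W.a₄ := by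
      rw [Affine.slope_of_Y_ne rfl hy', hneg, h₁, h₂]
      field_simp
      ring
    simp only [Affine.addX, Affine.addY, Affine.negAddY, Affine.negY, h₁, h₂, h₃]
    constructor
    · rintro ⟨rfl, rfl⟩
      exact ⟨hy, _, hs, by ring, by ring⟩
    · rintro ⟨-, l, hl, rfl, rfl⟩
      have : l = W.toAffine.slope x x y y :=
        mul_left_cancel₀ (mul_ne_zero two_ne_zero hy) (hl.trans hs.symm)
      rw [this]
      exact ⟨by ring, by ring⟩

end Halving

/-! ### Three distinct S₄-fields -/

section Assembly

open Equiv (Perm swap)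
open IntermediateField

variable {k Ω : Type*} [Field k] [Field Ω] [Algebra k Ω]

/-- The four numbers `X + Y + Z`, `X - Y - Z`, `-X + Y - Z`, `-X - Y + Z`. -/
def quartet (X Y Z : Ω) : Fin 4 → Ω := ![X + Y + Z, X - Y - Z, -X + Y - Z, -X - Y + Z]

theorem quartet_swap {X Y Z : Ω} {τ : Gal(Ω/k)} (hX : τ X = X) (hY : τ Y = -Z) (hZ : τ Z = -Y)
    (i : Fin 4) : τ (quartet X Y Z i) = quartet X Y Z (swap 0 1 i) := by
  have h : ∀ i : Fin 4, (swap 0 1 : Perm (Fin 4)) i = ![1, 0, 2, 3] i := by decide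
  rw [h]
  fin_cases i <;> simp [quartet, hX, hY, hZ] <;> ring

theorem quartet_threeCycle {X Y Z : Ω} {τ : Gal(Ω/k)} (hX : τ X = Y) (hY : τ Y = Z) (hZ : τ Z = X)
    (i : Fin 4) : τ (quartet X Y Z i) = quartet X Y Z (threeCycle i) := by
  have h : ∀ i : Fin 4, threeCycle i = ![0, 2, 3, 1] i := by decide
  rw [h]
  fin_cases i <;> simp [quartet, hX, hY, hZ] <;> ring

theorem quartet_not_const [CharZero Ω] {X Y Z : Ω} (hX : X ≠ 0) :
    ∃ i j, quartet X Y Z i ≠ quartet X Y Z j := by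
  by_contra! h
  have h₁ : X + Y + Z = X - Y - Z := h 0 1
  have h₂ : X + Y + Z = -X + Y - Z := h 0 2
  have h₃ : X + Y + Z = -X - Y + Z := h 0 3
  exact hX (by linear_combination (h₂ + h₃ - h₁) / 4)

theorem mem_adjoin_quartet [CharZero Ω] (X Y Z : Ω) :
    Y ∈ adjoin k (Set.range (quartet X Y Z)) := by
  have h : ∀ i, quartet X Y Z i ∈ adjoin k (Set.range (quartet X Y Z)) :=
    fun i => subset_adjoin _ _ ⟨i, rfl⟩
  have h₂ : (quartet X Y Z 0 + quartet X Y Z 2) / (2 : ℕ) = Y := by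
    simp [quartet]
    ring
  have h₃ := div_mem (add_mem (h 0) (h 2))
    (_root_.natCast_mem (adjoin k (Set.range (quartet X Y Z))) 2)
  rwa [h₂] at h₃

theorem apply_eq_of_mem_adjoin {S : Set Ω} {τ : Gal(Ω/k)} (h : ∀ x ∈ S, τ x = x) {y : Ω}
    (hy : y ∈ adjoin k S) : τ y = y := by
  have : adjoin k S ≤ fixedField (Subgroup.zpowers τ) := by
    rw [adjoin_le_iff]
    intro x hx
    rw [SetLike.mem_coe, mem_fixedField_iff]
    have : Subgroup.zpowers τ ≤ MulAction.stabilizer Gal(Ω/k) x := by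
      rw [Subgroup.zpowers_le]
      exact h x hx
    exact fun f hf => this hf
  exact (mem_fixedField_iff _ _).1 (this hy) τ (Subgroup.mem_zpowers τ)

/-- `Y ≠ 0` lies in the field generated by `quartet X Y Z`, so an automorphism negating it does not
fix that field. -/
theorem adjoin_ne_adjoin_quartet [CharZero Ω] {S : Set Ω} {X Y Z : Ω} {τ : Gal(Ω/k)}
    (h : ∀ x ∈ S, τ x = x) (hY : Y ≠ 0) (hτ : τ Y = -Y) :
    adjoin k S ≠ adjoin k (Set.range (quartet X Y Z)) := by
  intro he
  have h₁ := apply_eq_of_mem_adjoin h (he ▸ mem_adjoin_quartet X Y Z)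
  exact hY (self_eq_neg.1 (h₁.symm.trans hτ))

theorem quartet_fixed {X Y Z : Ω} {τ : Gal(Ω/k)} (hX : τ X = X) (hY : τ Y = Y) (hZ : τ Z = Z) :
    ∀ x ∈ Set.range (quartet X Y Z), τ x = x := by
  rintro _ ⟨i, rfl⟩
  fin_cases i <;> simp [quartet, hX, hY, hZ]

theorem quartet_mem {L : IntermediateField k Ω} {X Y Z : Ω} (hX : X ∈ L) (hY : Y ∈ L)
    (hZ : Z ∈ L) : Set.range (quartet X Y Z) ⊆ L := by
  rintro _ ⟨i, rfl⟩
  fin_cases i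
  · exact add_mem (add_mem hX hY) hZ
  · exact sub_mem (sub_mem hX hY) hZ
  · exact sub_mem (add_mem (neg_mem hX) hY) hZ
  · exact add_mem (sub_mem (neg_mem hX) hY) hZ

theorem units_one_cast_mul (x : Ω) : (((1 : ℤˣ) : ℤ) : Ω) * x = x := by simp

theorem units_neg_one_cast_mul (x : Ω) : (((-1 : ℤˣ) : ℤ) : Ω) * x = -x := by simp

theorem s4_subfields_of_holQ8 [CharZero Ω] [PerfectField k] [IsAlgClosed Ω]
    [Algebra.IsAlgebraic k Ω]
    {l t : Fin 4 → Ω} (hl : Function.Injective l) (ht : ∀ i, t i ≠ 0)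
    (hsum : l 3 = -(l 0 + l 1 + l 2))
    {g Y : k[X]} (hg : g.map (algebraMap k Ω) = ∏ i, (X - C (l i)))
    (hY : ∀ i, t i ^ 2 = aeval (l i) Y)
    (c : k) (hD : ∏ i, t i = algebraMap k Ω c * (Matrix.vandermonde l).det)
    (r₂ : t 1 * t 3 * (l 0 - l 2) = t 0 * t 2 * (l 3 - l 1))
    (r₃ : t 1 * t 2 * (l 0 - l 3) = t 0 * t 3 * (l 1 - l 2))
    (hne : ∃ i j, t i ^ 2 ≠ t j ^ 2)
    {f h₁ h₂ h₃ : k[X]} (hf : f.rootSet Ω ⊆ adjoin k (Set.range l ∪ Set.range t))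
    (hh₁ : h₁.map (algebraMap k Ω) = ∏ i, (X - C (quartet
      (2 * t 0 * t 1 * (l 2 - l 3) * (l 0 + l 1) ^ 2) (2 * t 0 * t 2 * (l 3 - l 1) * (l 0 + l 2) ^ 2)
      (2 * t 0 * t 3 * (l 1 - l 2) * (l 0 + l 3) ^ 2) i)))
    (hh₂ : h₂.map (algebraMap k Ω) = ∏ i, (X - C (quartet
      (2 * t 0 * t 1 * (l 2 - l 3) * ((l 0 + l 2) * (l 0 + l 3)))
      (2 * t 0 * t 2 * (l 3 - l 1) * ((l 0 + l 1) * (l 0 + l 3)))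
      (2 * t 0 * t 3 * (l 1 - l 2) * ((l 0 + l 1) * (l 0 + l 2))) i)))
    (hh₃ : h₃.map (algebraMap k Ω) = ∏ i, (X - C (t i ^ 2)))
    (e : Gal(adjoin k (f.rootSet Ω)/k) ≃* HolQ8) :
    {K | K ≤ adjoin k (f.rootSet Ω) ∧ IsGalois k K ∧ Nonempty (Gal(K/k) ≃* Perm (Fin 4))} =
      {adjoin k (h₁.rootSet Ω), adjoin k (h₂.rootSet Ω), adjoin k (h₃.rootSet Ω)} ∧
    {K | K ≤ adjoin k (f.rootSet Ω) ∧ IsGalois k K ∧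
      Nonempty (Gal(K/k) ≃* Perm (Fin 4))}.ncard = 3 := by
  have := isGalois_adjoin_rootSet (Ω := Ω) f
  have := finiteDimensional_adjoin_rootSet (Ω := Ω) f
  have hrank : 192 ≤ Module.finrank k (adjoin k (f.rootSet Ω)) := by
    rw [← IsGalois.card_aut_eq_finrank, Nat.card_congr e.toEquiv]
    exact le_card_holQ8
  obtain ⟨hL, hs⟩ := exists_algEquiv_signedPerm hl ht hg hY c hD (adjoin_le_iff.2 hf) hrank
  obtain ⟨hfin, hcard⟩ := setOf_s4_finite_and_ncard_le e
  have hlL : ∀ i, l i ∈ adjoin k (f.rootSet Ω) := fun i =>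
    hL ▸ subset_adjoin _ _ (Or.inl ⟨i, rfl⟩)
  have htL : ∀ i, t i ∈ adjoin k (f.rootSet Ω) := fun i =>
    hL ▸ subset_adjoin _ _ (Or.inr ⟨i, rfl⟩)
  generalize adjoin k (f.rootSet Ω) = L at *
  -- α is the transposition for h₁ and h₃, β the one for h₂, and γ the common 3-cycle. β carries its
  -- minus sign elsewhere because the factors (l₀ + lᵢ)(l₀ + lⱼ) contribute an extra sign. δ and ε
  -- separate the fields.
  obtain ⟨α, al, at'⟩ := hs ⟨(swap 0 1, ![1, 1, 1, -1]), by decide⟩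
  obtain ⟨β, bl, bt⟩ := hs ⟨(swap 0 1, ![1, 1, -1, 1]), by decide⟩
  obtain ⟨γ, cl, ct⟩ := hs ⟨(threeCycle, 1), by decide⟩
  obtain ⟨δ, dl, dt⟩ := hs ⟨(1, ![-1, -1, 1, 1]), by decide⟩
  obtain ⟨ε, el, et⟩ := hs ⟨(swap 0 1 * swap 2 3, ![1, -1, -1, 1]), by decide⟩
  have al₀ : α (l 0) = l 1 := al 0
  have al₁ : α (l 1) = l 0 := al 1
  have al₂ : α (l 2) = l 2 := al 2
  have al₃ : α (l 3) = l 3 := al 3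
  have at₀ : α (t 0) = t 1 := (at' 0).trans (units_one_cast_mul _)
  have at₁ : α (t 1) = t 0 := (at' 1).trans (units_one_cast_mul _)
  have at₂ : α (t 2) = t 2 := (at' 2).trans (units_one_cast_mul _)
  have at₃ : α (t 3) = -t 3 := (at' 3).trans (units_neg_one_cast_mul _)
  have bl₀ : β (l 0) = l 1 := bl 0
  have bl₁ : β (l 1) = l 0 := bl 1
  have bl₂ : β (l 2) = l 2 := bl 2
  have bl₃ : β (l 3) = l 3 := bl 3
  have bt₀ : β (t 0) = t 1 := (bt 0).trans (units_one_cast_mul _)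
  have bt₁ : β (t 1) = t 0 := (bt 1).trans (units_one_cast_mul _)
  have bt₂ : β (t 2) = -t 2 := (bt 2).trans (units_neg_one_cast_mul _)
  have bt₃ : β (t 3) = t 3 := (bt 3).trans (units_one_cast_mul _)
  have cl₀ : γ (l 0) = l 0 := cl 0
  have cl₁ : γ (l 1) = l 2 := cl 1
  have cl₂ : γ (l 2) = l 3 := cl 2
  have cl₃ : γ (l 3) = l 1 := cl 3
  have ct₀ : γ (t 0) = t 0 := (ct 0).trans (units_one_cast_mul _)
  have ct₁ : γ (t 1) = t 2 := (ct 1).trans (units_one_cast_mul _)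
  have ct₂ : γ (t 2) = t 3 := (ct 2).trans (units_one_cast_mul _)
  have ct₃ : γ (t 3) = t 1 := (ct 3).trans (units_one_cast_mul _)
  have dl₀ : δ (l 0) = l 0 := dl 0
  have dl₁ : δ (l 1) = l 1 := dl 1
  have dl₂ : δ (l 2) = l 2 := dl 2
  have dl₃ : δ (l 3) = l 3 := dl 3
  have dt₀ : δ (t 0) = -t 0 := (dt 0).trans (units_neg_one_cast_mul _)
  have dt₁ : δ (t 1) = -t 1 := (dt 1).trans (units_neg_one_cast_mul _)
  have dt₂ : δ (t 2) = t 2 := (dt 2).trans (units_one_cast_mul _)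
  have dt₃ : δ (t 3) = t 3 := (dt 3).trans (units_one_cast_mul _)
  have el₀ : ε (l 0) = l 1 := el 0
  have el₁ : ε (l 1) = l 0 := el 1
  have el₂ : ε (l 2) = l 3 := el 2
  have el₃ : ε (l 3) = l 2 := el 3
  have et₀ : ε (t 0) = t 1 := (et 0).trans (units_one_cast_mul _)
  have et₁ : ε (t 1) = -t 0 := (et 1).trans (units_neg_one_cast_mul _)
  have et₂ : ε (t 2) = -t 3 := (et 2).trans (units_neg_one_cast_mul _)
  have et₃ : ε (t 3) = t 2 := (et 3).trans (units_one_cast_mul _)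
  have q₁₂ : l 1 + l 2 = -(l 0 + l 3) := by rw [hsum]; ring
  have q₁₃ : l 1 + l 3 = -(l 0 + l 2) := by rw [hsum]; ring
  have d₁₂ : l 1 - l 2 ≠ 0 := fun h => absurd (hl (sub_eq_zero.1 h)) (by decide)
  have d₂₃ : l 2 - l 3 ≠ 0 := fun h => absurd (hl (sub_eq_zero.1 h)) (by decide)
  have d₃₁ : l 3 - l 1 ≠ 0 := fun h => absurd (hl (sub_eq_zero.1 h)) (by decide)
  -- Applying γ to l₀ + l₁ = 0 gives l₀ + l₂ = 0, hence l₁ = l₂.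
  have n₁ : l 0 + l 1 ≠ 0 := fun h => d₁₂ (by
    have := congrArg γ h
    rw [map_add, cl₀, cl₁, map_zero] at this
    linear_combination h - this)
  have n₂ : l 0 + l 2 ≠ 0 := fun h => d₂₃ (by
    have := congrArg γ h
    rw [map_add, cl₀, cl₂, map_zero] at this
    linear_combination h - this)
  have n₃ : l 0 + l 3 ≠ 0 := fun h => d₃₁ (by
    have := congrArg γ h
    rw [map_add, cl₀, cl₃, map_zero] at this
    linear_combination h - this)
  have hblock : ∀ m i j : Fin 4, 2 * t 0 * t m * (l i - l j) ∈ L := fun m i j =>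
    mul_mem (mul_mem (mul_mem (ofNat_mem L 2) (htL 0)) (htL m)) (sub_mem (hlL i) (hlL j))
  have hadd : ∀ i j : Fin 4, l i + l j ∈ L := fun i j => add_mem (hlL i) (hlL j)
  have hrow₁ := rootSet_eq_range hh₁
  have hrow₂ := rootSet_eq_range hh₂
  have hrow₃ := rootSet_eq_range hh₃
  have hK₁ : adjoin k (h₁.rootSet Ω) ∈
      {K | K ≤ L ∧ IsGalois k K ∧ Nonempty (Gal(K/k) ≃* Perm (Fin 4))} := by
    refine ⟨?_, isGalois_adjoin_rootSet h₁,
      galois_s4_of_perm hh₁ (quartet_not_const ?_) α γ (quartet_swap ?_ ?_ ?_)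
        (quartet_threeCycle ?_ ?_ ?_)⟩
    · rw [hrow₁, adjoin_le_iff]
      exact quartet_mem (mul_mem (hblock _ _ _) (pow_mem (hadd _ _) _))
        (mul_mem (hblock _ _ _) (pow_mem (hadd _ _) _))
        (mul_mem (hblock _ _ _) (pow_mem (hadd _ _) _))
    · exact mul_ne_zero (mul_ne_zero (mul_ne_zero (mul_ne_zero two_ne_zero (ht 0)) (ht 1)) d₂₃)
        (pow_ne_zero _ n₁)
    · simp only [map_mul, map_sub, map_add, map_pow, map_ofNat, al₀, al₁, al₂, al₃, at₀, at₁]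
      ring
    · simp only [map_mul, map_sub, map_add, map_pow, map_ofNat, al₀, al₁, al₂, al₃, at₀, at₂]
      rw [q₁₂]
      linear_combination (-2 * (l 0 + l 3) ^ 2) * r₃
    · simp only [map_mul, map_sub, map_add, map_pow, map_ofNat, al₀, al₁, al₂, al₃, at₀, at₃]
      rw [q₁₃]
      linear_combination (-2 * (l 0 + l 2) ^ 2) * r₂
    · simp only [map_mul, map_sub, map_add, map_pow, map_ofNat, cl₀, cl₁, cl₂, cl₃, ct₀, ct₁]
    · simp only [map_mul, map_sub, map_add, map_pow, map_ofNat, cl₀, cl₁, cl₂, cl₃, ct₀, ct₂]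
    · simp only [map_mul, map_sub, map_add, map_pow, map_ofNat, cl₀, cl₁, cl₂, cl₃, ct₀, ct₃]
  have hK₂ : adjoin k (h₂.rootSet Ω) ∈
      {K | K ≤ L ∧ IsGalois k K ∧ Nonempty (Gal(K/k) ≃* Perm (Fin 4))} := by
    refine ⟨?_, isGalois_adjoin_rootSet h₂,
      galois_s4_of_perm hh₂ (quartet_not_const ?_) β γ (quartet_swap ?_ ?_ ?_)
        (quartet_threeCycle ?_ ?_ ?_)⟩
    · rw [hrow₂, adjoin_le_iff]
      exact quartet_mem (mul_mem (hblock _ _ _) (mul_mem (hadd _ _) (hadd _ _)))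
        (mul_mem (hblock _ _ _) (mul_mem (hadd _ _) (hadd _ _)))
        (mul_mem (hblock _ _ _) (mul_mem (hadd _ _) (hadd _ _)))
    · exact mul_ne_zero (mul_ne_zero (mul_ne_zero (mul_ne_zero two_ne_zero (ht 0)) (ht 1)) d₂₃)
        (mul_ne_zero n₂ n₃)
    · simp only [map_mul, map_sub, map_add, map_ofNat, bl₀, bl₂, bl₃, bt₀, bt₁]
      rw [q₁₂, q₁₃]
      ring
    · simp only [map_mul, map_sub, map_add, map_ofNat, bl₀, bl₁, bl₃, bt₀, bt₂]
      rw [q₁₃]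
      linear_combination (-2 * (l 0 + l 1) * (l 0 + l 2)) * r₃
    · simp only [map_mul, map_sub, map_add, map_ofNat, bl₀, bl₁, bl₂, bt₀, bt₃]
      rw [q₁₂]
      linear_combination (-2 * (l 0 + l 1) * (l 0 + l 3)) * r₂
    · simp only [map_mul, map_sub, map_add, map_ofNat, cl₀, cl₂, cl₃, ct₀, ct₁]
      ring
    · simp only [map_mul, map_sub, map_add, map_ofNat, cl₀, cl₁, cl₃, ct₀, ct₂]
      ring
    · simp only [map_mul, map_sub, map_add, map_ofNat, cl₀, cl₁, cl₂, ct₀, ct₃]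
  have hK₃ : adjoin k (h₃.rootSet Ω) ∈
      {K | K ≤ L ∧ IsGalois k K ∧ Nonempty (Gal(K/k) ≃* Perm (Fin 4))} := by
    refine ⟨?_, isGalois_adjoin_rootSet h₃, galois_s4_of_perm hh₃ hne α γ ?_ ?_⟩
    · rw [hrow₃, adjoin_le_iff]
      rintro _ ⟨i, rfl⟩
      exact pow_mem (htL i) 2
    · intro i
      rw [map_pow, at', mul_pow, ← Int.cast_pow, ← Units.val_pow_eq_pow_val, Int.units_sq]
      simp
    · intro i
      rw [map_pow, ct, mul_pow, ← Int.cast_pow, ← Units.val_pow_eq_pow_val, Int.units_sq]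
      simp
  have hδ : ∀ x ∈ h₃.rootSet Ω, δ x = x := by
    rw [hrow₃]
    rintro _ ⟨i, rfl⟩
    simp only
    rw [map_pow, dt, mul_pow, ← Int.cast_pow, ← Units.val_pow_eq_pow_val, Int.units_sq]
    simp
  have y₁ : 2 * t 0 * t 2 * (l 3 - l 1) * (l 0 + l 2) ^ 2 ≠ 0 :=
    mul_ne_zero (mul_ne_zero (mul_ne_zero (mul_ne_zero two_ne_zero (ht 0)) (ht 2)) d₃₁)
      (pow_ne_zero _ n₂)
  have y₂ : 2 * t 0 * t 2 * (l 3 - l 1) * ((l 0 + l 1) * (l 0 + l 3)) ≠ 0 :=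
    mul_ne_zero (mul_ne_zero (mul_ne_zero (mul_ne_zero two_ne_zero (ht 0)) (ht 2)) d₃₁)
      (mul_ne_zero n₁ n₃)
  -- δ only changes signs of the tᵢ, so it fixes the roots tᵢ² of h₃, but it negates t₀t₂.
  have hne₃₁ : adjoin k (h₃.rootSet Ω) ≠ adjoin k (h₁.rootSet Ω) := by
    rw [hrow₁]
    refine adjoin_ne_adjoin_quartet hδ y₁ ?_
    simp only [map_mul, map_sub, map_add, map_pow, map_ofNat, dl₀, dl₁, dl₂, dl₃, dt₀, dt₂]
    ring
  have hne₃₂ : adjoin k (h₃.rootSet Ω) ≠ adjoin k (h₂.rootSet Ω) := by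
    rw [hrow₂]
    refine adjoin_ne_adjoin_quartet hδ y₂ ?_
    simp only [map_mul, map_sub, map_add, map_ofNat, dl₀, dl₁, dl₃, dt₀, dt₂]
    ring
  -- ε fixes X, Y, Z for h₁ and negates the Y of h₂.
  have hne₁₂ : adjoin k (h₁.rootSet Ω) ≠ adjoin k (h₂.rootSet Ω) := by
    rw [hrow₁, hrow₂]
    refine adjoin_ne_adjoin_quartet (quartet_fixed (τ := ε) ?_ ?_ ?_) y₂ ?_
    · simp only [map_mul, map_sub, map_add, map_pow, map_ofNat, el₀, el₁, el₂, el₃, et₀, et₁]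
      ring
    · simp only [map_mul, map_sub, map_add, map_pow, map_ofNat, el₀, el₁, el₂, el₃, et₀, et₂]
      rw [q₁₃]
      linear_combination (2 * (l 0 + l 2) ^ 2) * r₂
    · simp only [map_mul, map_sub, map_add, map_pow, map_ofNat, el₀, el₁, el₂, el₃, et₀, et₃]
      rw [q₁₂]
      linear_combination (2 * (l 0 + l 3) ^ 2) * r₃
    · simp only [map_mul, map_sub, map_add, map_ofNat, el₀, el₁, el₃, et₀, et₂]
      rw [q₁₂]
      linear_combination (-2 * (l 0 + l 1) * (l 0 + l 3)) * r₂
  have hthree : ({adjoin k (h₁.rootSet Ω), adjoin k (h₂.rootSet Ω), adjoin k (h₃.rootSet Ω)} :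
      Set (IntermediateField k Ω)).ncard = 3 :=
    Set.ncard_eq_three.2 ⟨_, _, _, hne₁₂, hne₃₁.symm, hne₃₂.symm, rfl⟩
  have hsub : ({adjoin k (h₁.rootSet Ω), adjoin k (h₂.rootSet Ω), adjoin k (h₃.rootSet Ω)} :
      Set (IntermediateField k Ω)) ⊆
        {K | K ≤ L ∧ IsGalois k K ∧ Nonempty (Gal(K/k) ≃* Perm (Fin 4))} := by
    rintro K (rfl | rfl | rfl)
    exacts [hK₁, hK₂, hK₃]
  have heq := Set.eq_of_subset_of_ncard_le hsub (hcard.trans hthree.ge) hfin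
  exact ⟨heq.symm, heq ▸ hthree⟩

end Assembly

/-! ### Application to the elliptic curve -/

section Final

open IntermediateField

variable {F : Type*} [Field F]

/-- This is the missing linear term of h₃. It excludes that all yᵢ equal one nonzero y, since then
4y³ = 0. -/
theorem IsTangentSlopes.esymm_three_y_eq_zero [CharZero F] {a b z w l₀ l₁ l₂ l₃ y₀ y₁ y₂ y₃ : F}
    (h : IsTangentSlopes a b z w l₀ l₁ l₂ l₃)
    (h₀ : y₀ = (l₀ ^ 3 - 3 * z * l₀ - 2 * w) / 2) (h₁ : y₁ = (l₁ ^ 3 - 3 * z * l₁ - 2 * w) / 2)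
    (h₂ : y₂ = (l₂ ^ 3 - 3 * z * l₂ - 2 * w) / 2) (h₃ : y₃ = (l₃ ^ 3 - 3 * z * l₃ - 2 * w) / 2) :
    y₁ * y₂ * y₃ + y₀ * y₂ * y₃ + y₀ * y₁ * y₃ + y₀ * y₁ * y₂ = 0 := by
  obtain ⟨e₀, e₁, e₂, e₃⟩ := h.y_eq
  rw [h₀, h₁, h₂, h₃, e₀, e₁, e₂, e₃]
  ring

theorem det_vandermonde_fin_four (l : Fin 4 → F) : (Matrix.vandermonde l).det =
    -((l 0 - l 1) * (l 2 - l 3) * ((l 0 - l 2) * (l 3 - l 1)) * ((l 0 - l 3) * (l 1 - l 2))) := by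
  have h : ∀ i : Fin 4, Finset.Ioi i = ![{1, 2, 3}, {2, 3}, {3}, ∅] i := by decide
  rw [Matrix.det_vandermonde]
  simp only [h, Fin.prod_univ_four, Matrix.cons_val]
  simp
  ring

theorem exists_sqrt_with_prod [CharZero F] [IsAlgClosed F] (y : Fin 4 → F) (D : F)
    (h : D ^ 2 = y 0 * y 1 * y 2 * y 3) :
    ∃ t : Fin 4 → F, (∀ i, t i ^ 2 = y i) ∧ t 0 * t 1 * t 2 * t 3 = D := by
  choose t ht using fun i => IsAlgClosed.exists_pow_nat_eq (y i) two_pos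
  have hsq : (t 0 * t 1 * t 2 * t 3) ^ 2 = D ^ 2 := by rw [h, ← ht, ← ht, ← ht, ← ht]; ring
  rcases sq_eq_sq_iff_eq_or_eq_neg.1 hsq with h | h
  · exact ⟨t, ht, h⟩
  · refine ⟨![-t 0, t 1, t 2, t 3], fun i => ?_, ?_⟩
    · rw [← ht]
      fin_cases i <;> simp
    · simp
      linear_combination -h

theorem shortCurve_baseChange (a b : ℚ) :
    ((shortCurve a b).baseChange (AlgebraicClosure ℚ)) =
      ⟨0, 0, 0, algebraMap ℚ _ a, algebraMap ℚ _ b⟩ := by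
  simp [WeierstrassCurve.baseChange, WeierstrassCurve.map, shortCurve]

theorem dInv_ne_zero {a b : ℚ} (h : (shortCurve a b).IsElliptic) : dInv a b ≠ 0 := by
  have h := h.isUnit.ne_zero
  intro h0
  apply h
  rw [dInv] at h0
  simp only [WeierstrassCurve.Δ, WeierstrassCurve.b₂, WeierstrassCurve.b₄, WeierstrassCurve.b₆,
    WeierstrassCurve.b₈, shortCurve]
  linear_combination (-16) * h0

section Slopes

local notation "ι" => algebraMap ℚ (AlgebraicClosure ℚ)

variable {a b z w : ℚ} {l : Fin 4 → AlgebraicClosure ℚ}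

theorem h3Poly_map (h : IsTangentSlopes (ι a) (ι b) (ι z) (ι w) (l 0) (l 1) (l 2) (l 3)) :
    (h3Poly a b z w).map (algebraMap ℚ (AlgebraicClosure ℚ)) =
      ∏ i, (X - C ((l i ^ 3 - 3 * ι z * l i - 2 * ι w) / 2)) := by
  refine Polynomial.funext fun x => ?_
  rw [Fin.prod_univ_four]
  simp only [eval_mul, eval_sub, eval_X, eval_C]
  rw [← h.h3_eq]
  simp [h3Poly, dInv]

theorem eval_h3Poly (a b z w : ℚ) (x : AlgebraicClosure ℚ) :
    aeval x (h3Poly a b z w) = x ^ 4 - 8 * ι w * x ^ 3 +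
      6 * (2 * ι a * ι z + 3 * ι b) * x ^ 2 - (4 * ι a ^ 3 + 27 * ι b ^ 2) := by
  simp [h3Poly, dInv]

/-- [2]Q = P means that the tangent at Q passes through -P, so its slope is one of the lᵢ. -/
theorem rootSet_h3Poly (hE : (shortCurve a b).IsElliptic)
    (h : IsTangentSlopes (ι a) (ι b) (ι z) (ι w) (l 0) (l 1) (l 2) (l 3)) :
    (h3Poly a b z w).rootSet (AlgebraicClosure ℚ) = halvingYCoords (shortCurve a b) z w := by
  classical
  have hroot := rootSet_eq_range (h3Poly_map h)
  have hd := dInv_ne_zero hE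
  have hne : h3Poly a b z w ≠ 0 := by
    intro h0
    have := congrArg (fun p => p.eval 0) h0
    simp [h3Poly] at this
    exact hd this
  have ha₁ : ((shortCurve a b).baseChange (AlgebraicClosure ℚ)).a₁ = 0 := by
    rw [shortCurve_baseChange]
  have ha₂ : ((shortCurve a b).baseChange (AlgebraicClosure ℚ)).a₂ = 0 := by
    rw [shortCurve_baseChange]
  have ha₃ : ((shortCurve a b).baseChange (AlgebraicClosure ℚ)).a₃ = 0 := by
    rw [shortCurve_baseChange]
  have ha₄ : ((shortCurve a b).baseChange (AlgebraicClosure ℚ)).a₄ = ι a := by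
    rw [shortCurve_baseChange]
  have ha₆ : ((shortCurve a b).baseChange (AlgebraicClosure ℚ)).a₆ = ι b := by
    rw [shortCurve_baseChange]
  have heq : ∀ x y, ((shortCurve a b).baseChange (AlgebraicClosure ℚ)).toAffine.Equation x y ↔
      y ^ 2 = x ^ 3 + ι a * x + ι b := by
    intro x y
    rw [WeierstrassCurve.Affine.equation_iff, ha₁, ha₂, ha₃, ha₄, ha₆]
    simp
  have hΔ : ((shortCurve a b).baseChange (AlgebraicClosure ℚ)).Δ ≠ 0 := by
    rw [WeierstrassCurve.baseChange, WeierstrassCurve.map_Δ]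
    exact (_root_.map_ne_zero _).2 hE.isUnit.ne_zero
  have hns : ∀ x y, y ^ 2 = x ^ 3 + ι a * x + ι b →
      ((shortCurve a b).baseChange (AlgebraicClosure ℚ)).toAffine.Nonsingular x y := fun x y hxy =>
    (WeierstrassCurve.Affine.equation_iff_nonsingular_of_Δ_ne_zero hΔ).1 ((heq x y).2 hxy)
  have hzw : ι w ^ 2 = ι z ^ 3 + ι a * ι z + ι b := by linear_combination -h.curve
  ext y
  constructor
  · intro hy
    have hy0 : y ≠ 0 := by
      rintro rfl
      rw [mem_rootSet_of_ne hne] at hy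
      have : aeval (0 : AlgebraicClosure ℚ) (h3Poly a b z w) = -ι (dInv a b) := by
        simp [h3Poly]
      rw [this, neg_eq_zero, map_eq_zero] at hy
      exact hd hy
    obtain ⟨i, hi⟩ := hroot.subset hy
    have hg : l i ^ 4 - 6 * ι z * l i ^ 2 - 8 * ι w * l i - 3 * ι z ^ 2 - 4 * ι a = 0 := by
      rw [h.quartic_eq]
      fin_cases i <;> simp
    simp only at hi
    generalize l i = m at hi hg
    -- The abscissa comes from solving z = m² - 2x in the doubling formula.
    have hQ := hns ((m ^ 2 - ι z) / 2) y (by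
      rw [← hi]
      linear_combination ((m ^ 2 - ι z) / 2 - ι z) / 4 * hg + hzw)
    refine ⟨(m ^ 2 - ι z) / 2, hQ, hns _ _ hzw,
      (two_nsmul_some_eq_iff ha₁ ha₂ ha₃ _ _).2 ⟨hy0, m, ?_, ?_, ?_⟩⟩
    · rw [ha₄, ← hi]
      linear_combination hg / 4
    · ring
    · rw [← hi]
      ring
  · rintro ⟨x, hQ, hP', h2⟩
    obtain ⟨-, m, h₁, h₂, h₃⟩ := (two_nsmul_some_eq_iff ha₁ ha₂ ha₃ _ _).1 h2
    have hxy := (heq x y).1 hQ.1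
    rw [mem_rootSet_of_ne hne, eval_h3Poly]
    rw [ha₄] at h₁
    -- Conversely a, b, z, w are polynomials in x, y and the slope m, and h₃(y) = 0 becomes an
    -- identity.
    have ea : ι a = 2 * y * m - 3 * x ^ 2 := by linear_combination -h₁
    have eb : ι b = y ^ 2 - x ^ 3 - ι a * x := by linear_combination -hxy
    rw [eb, h₃, h₂, ea]
    ring

theorem h1Poly_map (h : IsTangentSlopes (ι a) (ι b) (ι z) (ι w) (l 0) (l 1) (l 2) (l 3))
    {t : Fin 4 → AlgebraicClosure ℚ}
    (ht : ∀ i, t i ^ 2 = (l i ^ 3 - 3 * ι z * l i - 2 * ι w) / 2)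
    (hD : t 0 * t 1 * t 2 * t 3 = (l 0 - l 1) * (l 2 - l 3) * ((l 0 - l 2) * (l 3 - l 1)) *
      ((l 0 - l 3) * (l 1 - l 2)) / 64) :
    (h1Poly a b z w).map (algebraMap ℚ (AlgebraicClosure ℚ)) = ∏ i, (X - C (quartet
      (2 * t 0 * t 1 * (l 2 - l 3) * (l 0 + l 1) ^ 2) (2 * t 0 * t 2 * (l 3 - l 1) * (l 0 + l 2) ^ 2)
      (2 * t 0 * t 3 * (l 1 - l 2) * (l 0 + l 3) ^ 2) i)) ∧
    (h2Poly a b z w).map (algebraMap ℚ (AlgebraicClosure ℚ)) = ∏ i, (X - C (quartet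
      (2 * t 0 * t 1 * (l 2 - l 3) * ((l 0 + l 2) * (l 0 + l 3)))
      (2 * t 0 * t 2 * (l 3 - l 1) * ((l 0 + l 1) * (l 0 + l 3)))
      (2 * t 0 * t 3 * (l 1 - l 2) * ((l 0 + l 1) * (l 0 + l 2))) i)) := by
  obtain ⟨b₁, b₂, b₃, b₄⟩ := h.blocks (ht 0) (ht 1) (ht 2) (ht 3) hD
  obtain ⟨c₁, c₂, c₃, c₄, c₅, c₆⟩ := h.resolvent_coeffs b₁ b₂ b₃ b₄ _ rfl
  constructor
  · refine Polynomial.funext fun x => ?_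
    rw [Fin.prod_univ_four]
    simp only [eval_mul, eval_sub, eval_X, eval_C, quartet, Matrix.cons_val]
    rw [quartet_prod, c₁, c₂, c₃]
    simp [h1Poly, dInv]
  · refine Polynomial.funext fun x => ?_
    rw [Fin.prod_univ_four]
    simp only [eval_mul, eval_sub, eval_X, eval_C, quartet, Matrix.cons_val]
    rw [quartet_prod, c₄, c₅, c₆]
    simp [h2Poly, dInv]

theorem s4Subfields_splittingSubfield_fQ8 (hE : (shortCurve a b).IsElliptic)
    (h : IsTangentSlopes (ι a) (ι b) (ι z) (ι w) (l 0) (l 1) (l 2) (l 3))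
    (e : Gal(splittingSubfield (fQ8 a b z w)/ℚ) ≃* HolQ8) :
    s4Subfields (splittingSubfield (fQ8 a b z w)) =
      {splittingSubfield (h1Poly a b z w), splittingSubfield (h2Poly a b z w),
        splittingSubfield (h3Poly a b z w)} ∧
    (s4Subfields (splittingSubfield (fQ8 a b z w))).ncard = 3 := by
  have hd : ι (dInv a b) ≠ 0 := (_root_.map_ne_zero _).2 (dInv_ne_zero hE)
  have hd' : ι (dInv a b) = 4 * ι a ^ 3 + 27 * ι b ^ 2 := by simp [dInv]
  rw [hd', h.d_eq] at hd
  have hpqr : (l 0 - l 1) * (l 2 - l 3) * ((l 0 - l 2) * (l 3 - l 1)) *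
      ((l 0 - l 3) * (l 1 - l 2)) ≠ 0 := by
    intro h0
    rw [h0] at hd
    simp at hd
  have hinj : Function.Injective l := by
    simp only [ne_eq, mul_eq_zero, sub_eq_zero, not_or] at hpqr
    obtain ⟨⟨⟨h₁, h₂⟩, h₃, h₄⟩, h₅, h₆⟩ := hpqr
    intro i j hij
    fin_cases i <;> fin_cases j <;> first | rfl | exact absurd hij ‹_› | exact absurd hij.symm ‹_›
  obtain ⟨t, ht, hD⟩ := exists_sqrt_with_prod
    (fun i => (l i ^ 3 - 3 * ι z * l i - 2 * ι w) / 2)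
    ((l 0 - l 1) * (l 2 - l 3) * ((l 0 - l 2) * (l 3 - l 1)) * ((l 0 - l 3) * (l 1 - l 2)) / 64)
    (by
      obtain ⟨e₀, e₁, e₂, e₃⟩ := h.y_eq
      rw [e₀, e₁, e₂, e₃]
      ring)
  have ht0 : ∀ i, t i ≠ 0 := by
    have h64 : (64 : AlgebraicClosure ℚ) ≠ 0 := by norm_num
    have := hD ▸ div_ne_zero hpqr h64
    simp only [ne_eq, mul_eq_zero, not_or] at this
    obtain ⟨⟨⟨h₀, h₁⟩, h₂⟩, h₃⟩ := this
    intro i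
    fin_cases i <;> assumption
  obtain ⟨r₂, r₃⟩ := h.block_relations (ht 0) (ht 2) (ht 3) (ht0 0) (ht0 2) (ht0 3) hD
  obtain ⟨hm₁, hm₂⟩ := h1Poly_map h ht hD
  have hm₃ : (h3Poly a b z w).map (algebraMap ℚ (AlgebraicClosure ℚ)) = ∏ i, (X - C (t i ^ 2)) := by
    rw [h3Poly_map h]
    exact Finset.prod_congr rfl fun i _ => by rw [ht]
  have hg : (X ^ 4 - C (6 * z) * X ^ 2 - C (8 * w) * X - C (3 * z ^ 2 + 4 * a) : ℚ[X]).map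
      (algebraMap ℚ (AlgebraicClosure ℚ)) = ∏ i, (X - C (l i)) := by
    refine Polynomial.funext fun x => ?_
    rw [Fin.prod_univ_four]
    simp only [eval_mul, eval_sub, eval_X, eval_C]
    rw [← h.quartic_eq]
    simp
    ring
  have hY : ∀ i, t i ^ 2 = aeval (l i) (C (1 / 2) * (X ^ 3 - C (3 * z) * X - C (2 * w)) : ℚ[X]) := by
    intro i
    rw [ht]
    simp
    ring
  have hvan : ∏ i, t i = ι (-1 / 64) * (Matrix.vandermonde l).det := by
    rw [Fin.prod_univ_four, hD, det_vandermonde_fin_four]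
    simp
    ring
  have hne : ∃ i j, t i ^ 2 ≠ t j ^ 2 := by
    by_contra! hall
    have h0 := h.esymm_three_y_eq_zero (ht 0) (ht 1) (ht 2) (ht 3)
    rw [hall 1 0, hall 2 0, hall 3 0] at h0
    have : (4 : AlgebraicClosure ℚ) * (t 0) ^ 6 = 0 := by linear_combination h0
    exact mul_ne_zero (by norm_num) (pow_ne_zero 6 (ht0 0)) this
  have hf : (fQ8 a b z w).rootSet (AlgebraicClosure ℚ) ⊆
      adjoin ℚ (Set.range l ∪ Set.range t) := by
    intro y hy
    have hy := (mem_rootSet'.1 hy).2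
    -- f(x) = h₃(x²), so y² is some tᵢ² and y = ±tᵢ.
    have h0 : ((h3Poly a b z w).map (algebraMap ℚ (AlgebraicClosure ℚ))).eval (y ^ 2) = 0 := by
      rw [← hy]
      simp [h3Poly, fQ8]
      ring
    rw [hm₃, eval_prod, Finset.prod_eq_zero_iff] at h0
    obtain ⟨i, -, hi⟩ := h0
    rw [eval_sub, eval_X, eval_C, sub_eq_zero] at hi
    have hti : t i ∈ adjoin ℚ (Set.range l ∪ Set.range t) := subset_adjoin _ _ (Or.inr ⟨i, rfl⟩)
    rcases sq_eq_sq_iff_eq_or_eq_neg.1 hi with rfl | rfl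
    · exact hti
    · exact neg_mem hti
  have : Algebra.IsAlgebraic ℚ (AlgebraicClosure ℚ) := AlgebraicClosure.isAlgebraic ℚ
  exact s4_subfields_of_holQ8 hinj ht0 h.sum hg hY _ hvan r₂ r₃ hne hf hm₁ hm₂ hm₃ e

end Slopes

end Final

theorem mainTheorem2 :
    (s4Kernels HolQ8).ncard = 3 ∧
    ∀ (a b z w : ℚ), (shortCurve a b).IsElliptic → (shortCurve a b).toAffine.Equation z w →
      (h3Poly a b z w).rootSet (AlgebraicClosure ℚ) = halvingYCoords (shortCurve a b) z w ∧
      (Nonempty (Gal(splittingSubfield (fQ8 a b z w)/ℚ) ≃* HolQ8) →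
        s4Subfields (splittingSubfield (fQ8 a b z w)) =
          {splittingSubfield (h1Poly a b z w), splittingSubfield (h2Poly a b z w),
            splittingSubfield (h3Poly a b z w)} ∧
        (s4Subfields (splittingSubfield (fQ8 a b z w))).ncard = 3) := by
  refine ⟨ncard_s4Kernels_holQ8, fun a b z w hE hP => ?_⟩
  have hcurve : b = w ^ 2 - z ^ 3 - a * z := by
    rw [WeierstrassCurve.Affine.equation_iff] at hP
    simp [shortCurve] at hP
    linear_combination -hP
  have hcurve' := congrArg (algebraMap ℚ (AlgebraicClosure ℚ)) hcurve
  simp only [map_sub, map_mul, map_pow] at hcurve'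
  obtain ⟨l₀, l₁, l₂, l₃, h⟩ := exists_isTangentSlopes hcurve'
  exact ⟨rootSet_h3Poly (l := ![l₀, l₁, l₂, l₃]) hE h, fun ⟨e⟩ =>
    s4Subfields_splittingSubfield_fQ8 (l := ![l₀, l₁, l₂, l₃]) hE h e⟩
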